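/- Let $Z$ (samples) and $F$ (models) be measurable spaces, let $\ell: Z\times F\to[0,1]$ be a measurable loss, let $m,n\ge 1$, and write $\mathcal M(X)$ for the set of probability distributions on $X$. Put $\ell(z,Q)=\mathbb E_{f\sim Q}\,\ell(z,f)$ for $Q\in\mathcal M(F)$. Let $\mathcal A$ be a family of stochastic learning algorithms $A:Z^m\to\mathcal M(F)$, equipped with a $\sigma$-algebra for which $(A,S)\mapsto A(S)$ is measurable. A task is a pair $(D,S)$ with $D\in\mathcal M(Z)$ and $S\in Z^m$; let $\tau$ be a distribution of tasks under which, given $D$, the dataset $S=(z_1,\dots,z_m)$ is sampled i.i.d. from $D$. The training tasks $(D_1,S_1),\dots,(D_n,S_n)$, with $S_i=(z_{i,1},\dots,z_{i,m})$, are sampled i.i.d. from $\tau$. For $\rho\in\mathcal M(\mathcal A)$ let $$\mathrm{er}(\rho)=\mathbb E_{A\sim\rho}\,\mathbb E_{(D,S)\sim\tau}\,\mathbb E_{z\sim D}\,\ell(z,A(S)),\qquad \widehat{\mathrm{er}}(\rho)=\mathbb E_{A\sim\rho}\frac1n\sum_{i=1}^n\frac1m\sum_{j=1}^m\ell(z_{i,j},A(S_i)).$$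 **Theorem.** For any fixed meta-prior $\pi\in\mathcal M(\mathcal A)$, any fixed hyper-prior $\mathcal P\in\mathcal M(\mathcal M(F))$ and any $\delta>0$, with probability at least $1-\delta$ over the sampling of the training tasks, it holds simultaneously for all meta-posteriors $\rho\in\mathcal M(\mathcal A)$ and all hyper-posterior mappings $\mathcal Q:\mathcal A\to\mathcal M(\mathcal M(F))$ that $$\mathrm{er}(\rho)\le\widehat{\mathrm{er}}(\rho)+\sqrt{\frac{\mathrm{KL}(\rho\|\pi)+\log\frac{4\sqrt n}{\delta}}{2n}}+\mathbb E_{A\sim\rho}\sqrt{\frac{C(A,\mathcal Q,\mathcal P)+\log\frac{8mn}{\delta}+1}{2mn}},$$ where $$C(A,\mathcal Q,\mathcal P)=\mathrm{KL}(\mathcal Q(A)\|\mathcal P)+\mathbb E_{P\sim\mathcal Q(A)}\sum_{i=1}^n\mathrm{KL}(A(S_i)\|P),$$ and the right-hand side may be $+\infty$. -/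

import Mathlib

open MeasureTheory ProbabilityTheory InformationTheory
open scoped ENNReal

noncomputable section

namespace MetaLearning

/-- A dataset of `m` examples from the sample space `Z`. -/
abbrev Dataset (Z : Type*) (m : ℕ) := Fin m → Z

/-- A task `(D, S)`: a data distribution together with a dataset of size `m`. -/
abbrev Task (Z : Type*) [MeasurableSpace Z] (m : ℕ) := ProbabilityMeasure Z × Dataset Z m

/-- A stochastic learning algorithm: it maps a dataset to a distribution over models. -/
abbrev LearningAlgorithm (Z F : Type*) [MeasurableSpace F] (m : ℕ) :=
  Dataset Z m → ProbabilityMeasure F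

/-- The distributions over priors, i.e. over probability distributions over models. -/
abbrev HyperDistribution (F : Type*) [MeasurableSpace F] :=
  ProbabilityMeasure (ProbabilityMeasure F)

theorem measurable_pi_const (Z : Type*) [MeasurableSpace Z] (m : ℕ) :
    Measurable (fun D : ProbabilityMeasure Z => Measure.pi (fun _ : Fin m => (D : Measure Z))) := by
  refine Measurable.measure_of_isPiSystem_of_isProbabilityMeasure generateFrom_pi.symm
    isPiSystem_pi ?_
  rintro s ⟨t, ht, rfl⟩
  simp only [Measure.pi_pi]
  refine Finset.measurable_prod _ fun i _ => ?_
  exact (Measure.measurable_coe (ht i (Set.mem_univ i))).comp measurable_subtype_coe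

/-- Sampling `m` examples i.i.d. from a data distribution `D`. -/
def sampleKernel (Z : Type*) [MeasurableSpace Z] (m : ℕ) :
    Kernel (ProbabilityMeasure Z) (Dataset Z m) where
  toFun D := Measure.pi (fun _ : Fin m => (D : Measure Z))
  measurable' := measurable_pi_const Z m

instance (Z : Type*) [MeasurableSpace Z] (m : ℕ) : IsMarkovKernel (sampleKernel Z m) :=
  ⟨fun D => inferInstanceAs
    (IsProbabilityMeasure (Measure.pi (fun _ : Fin m => (D : Measure Z))))⟩

/-- The distribution of a task `(D, S)` when the data distribution `D` is drawn from the task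
environment `ν` and then `S` consists of `m` i.i.d. examples from `D`. -/
def taskLaw {Z : Type*} [MeasurableSpace Z] (ν : ProbabilityMeasure (ProbabilityMeasure Z))
    (m : ℕ) : Measure (Task Z m) :=
  (ν : Measure (ProbabilityMeasure Z)) ⊗ₘ sampleKernel Z m

instance {Z : Type*} [MeasurableSpace Z] (ν : ProbabilityMeasure (ProbabilityMeasure Z)) (m : ℕ) :
    IsProbabilityMeasure (taskLaw ν m) := by
  unfold taskLaw
  infer_instance

/-- The joint distribution of `n` training tasks, drawn i.i.d. -/
def trainingLaw {Z : Type*} [MeasurableSpace Z] (ν : ProbabilityMeasure (ProbabilityMeasure Z))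
    (m n : ℕ) : Measure (Fin n → Task Z m) :=
  Measure.pi (fun _ : Fin n => taskLaw ν m)

instance {Z : Type*} [MeasurableSpace Z] (ν : ProbabilityMeasure (ProbabilityMeasure Z))
    (m n : ℕ) : IsProbabilityMeasure (trainingLaw ν m n) := by
  unfold trainingLaw
  infer_instance

section Risks

variable {Z F : Type*} [MeasurableSpace Z] [MeasurableSpace F]

/-- The loss `ℓ(z, Q) = E_{f ∼ Q} ℓ(z, f)` of a stochastic model `Q`. -/
def stochLoss (ℓ : Z → F → ℝ) (z : Z) (Q : ProbabilityMeasure F) : ℝ :=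
  ∫ f, ℓ z f ∂(Q : Measure F)

/-- The expected risk `E_{z ∼ D} ℓ(z, Q)`. -/
def expectedRisk (ℓ : Z → F → ℝ) (D : ProbabilityMeasure Z) (Q : ProbabilityMeasure F) : ℝ :=
  ∫ z, stochLoss ℓ z Q ∂(D : Measure Z)

/-- The empirical risk of a stochastic model on a dataset. -/
def empiricalRisk {m : ℕ} (ℓ : Z → F → ℝ) (S : Dataset Z m) (Q : ProbabilityMeasure F) : ℝ :=
  (1 / (m : ℝ)) * ∑ j, stochLoss ℓ (S j) Q

variable {𝒜 : Type*} [MeasurableSpace 𝒜] {m n : ℕ}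

/-- The risk `er(ρ)` of a meta-posterior on a future task. The family `alg` assigns to each label
in `𝒜` its learning algorithm. -/
def metaRisk (ℓ : Z → F → ℝ) (alg : 𝒜 → LearningAlgorithm Z F m)
    (ν : ProbabilityMeasure (ProbabilityMeasure Z)) (ρ : ProbabilityMeasure 𝒜) : ℝ :=
  ∫ A, ∫ t, expectedRisk ℓ t.1 (alg A t.2) ∂(taskLaw ν m) ∂(ρ : Measure 𝒜)

/-- The empirical risk of a meta-posterior on the datasets `S` of the training tasks. -/
def metaEmpiricalRisk (ℓ : Z → F → ℝ) (alg : 𝒜 → LearningAlgorithm Z F m)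
    (S : Fin n → Dataset Z m) (ρ : ProbabilityMeasure 𝒜) : ℝ :=
  ∫ A, (1 / (n : ℝ)) * ∑ i, empiricalRisk ℓ (S i) (alg A (S i)) ∂(ρ : Measure 𝒜)

/-- The within-task complexity
`KL(𝒬(A) ‖ 𝒫) + E_{P ∼ 𝒬(A)} ∑ i, KL(A(S i) ‖ P)`, possibly infinite. -/
def complexity (alg : 𝒜 → LearningAlgorithm Z F m) (S : Fin n → Dataset Z m)
    (hyperPrior : HyperDistribution F) (hyperPost : 𝒜 → HyperDistribution F) (A : 𝒜) : ℝ≥0∞ :=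
  klDiv (hyperPost A : Measure (ProbabilityMeasure F))
      (hyperPrior : Measure (ProbabilityMeasure F)) +
    ∫⁻ P, ∑ i, klDiv (alg A (S i) : Measure F) (P : Measure F)
      ∂(hyperPost A : Measure (ProbabilityMeasure F))

/-- The task-level term `√((KL(ρ ‖ π) + log (4 √n / δ)) / (2 n))`, possibly infinite. -/
def taskTerm (n : ℕ) (δ : ℝ) (π ρ : ProbabilityMeasure 𝒜) : ℝ≥0∞ :=
  ((klDiv (ρ : Measure 𝒜) (π : Measure 𝒜) + ENNReal.ofReal (Real.log (4 * Real.sqrt n / δ))) /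
    (2 * n)) ^ (1 / 2 : ℝ)

/-- The within-task term `E_{A ∼ ρ} √((C(A) + log (8 m n / δ) + 1) / (2 m n))`, possibly
infinite, where `C` is the within-task complexity. -/
def withinTerm (alg : 𝒜 → LearningAlgorithm Z F m) (S : Fin n → Dataset Z m) (δ : ℝ)
    (hyperPrior : HyperDistribution F) (hyperPost : 𝒜 → HyperDistribution F)
    (ρ : ProbabilityMeasure 𝒜) : ℝ≥0∞ :=
  ∫⁻ A, ((complexity alg S hyperPrior hyperPost A +
      ENNReal.ofReal (Real.log (8 * m * n / δ)) + 1) / (2 * m * n)) ^ (1 / 2 : ℝ)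
    ∂(ρ : Measure 𝒜)

end Risks

end MetaLearning

end

/-! The excess risk of a meta-posterior splits, for each algorithm, into a gap between tasks
(the mean of the expected risk over the task law against its average over the training tasks)
and a gap within tasks (expected against empirical risk of the learned models). Each gap is
controlled on an event of probability at least `1 - δ / 2` that does not depend on the
posteriors, by combining Markov's inequality for an exponential moment under the prior with the
Donsker–Varadhan change of measure `∫ g dμ - log ∫ exp g dν ≤ KL(μ ‖ ν)`
(`ofReal_integral_sub_log_integral_exp_le_klDiv`).

Between tasks, the moment is that of `2 n Δ²`, where `Δ` is the deviation of an average of `n`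
i.i.d. `[0, 1]`-valued variables, and it is at most `2 √n`
(`integral_exp_two_mul_sq_sub_mean_le`). Convexity in each coordinate reduces this to Bernoulli
variables; Pinsker's inequality then removes the mean, leaving
`∑ₖ C(n, k) (k / n) ^ k (1 - k / n) ^ (n - k)`. Its terms are compared with the weights
`C(2k, k) C(2(n - k), n - k) / 4 ^ n` of the discrete arcsine law, which sum to `1`; the worst
ratio is attained at `k = 0` and equals `4 ^ n / C(2n, n) ≤ 2 √n`
(`sum_choose_mul_maxLikelihood_le`).

Within tasks, all `N = m n` losses count at once. The square `2 N x²` of the gap is, up to the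
additive constant `1`, the largest of the tangents `4 N (k / N) x - 2 N (k / N)²` with
`0 ≤ k ≤ N`. Each tangent is a sum over the tasks of a function of a single model, so applying
the change of measure once per task and once more between hyper-posterior and hyper-prior
produces exactly the within-task complexity (`ofReal_sum_integral_sub_log_integral_prod_le`),
while by Hoeffding's lemma and the independence of the tasks the matching moments are at most
`1` (`MetaLearning.integral_withinMoment_le_one`). This bound holds for all model posteriors
simultaneously, hence for all algorithms, and can be averaged over the meta-posterior outside
the square root.

No measurability is available for `P ↦ KL(Q ‖ P)` or for the hyper-posterior mapping. The lower
integrals `∫⁻` of such functions are only ever bounded below, by integrals of measurable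
functions.
-/

/-! ### The binomial sum of maximal likelihoods -/

open Finset in
/-- The discrete arcsine weights `C(2i, i) C(2j, j) / 4 ^ n`, `i + j = n`, sum to `1`. -/
theorem Nat.sum_antidiagonal_centralBinom_mul (n : ℕ) :
    ∑ p ∈ antidiagonal n, p.1.centralBinom * p.2.centralBinom = 4 ^ n := by
  induction n with
  | zero => simp
  | succ n ih =>
    -- Weighting the terms by the first index gives half of what weighting by `n` gives.
    have hsymm : ∀ N : ℕ, N * ∑ p ∈ antidiagonal N, p.1.centralBinom * p.2.centralBinom
        = 2 * ∑ p ∈ antidiagonal N, p.1 * (p.1.centralBinom * p.2.centralBinom) := by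
      intro N
      have hswap : ∑ p ∈ antidiagonal N, p.1 * (p.1.centralBinom * p.2.centralBinom)
          = ∑ p ∈ antidiagonal N, p.2 * (p.1.centralBinom * p.2.centralBinom) := by
        rw [← Finset.Nat.sum_antidiagonal_swap]
        exact sum_congr rfl fun p _ => by simp [mul_comm]
      rw [two_mul]
      nth_rewrite 2 [hswap]
      rw [← sum_add_distrib, mul_sum]
      refine sum_congr rfl fun p hp => ?_
      rw [← mem_antidiagonal.mp hp, add_mul]
    have hrec : (n + 1) * ∑ p ∈ antidiagonal (n + 1), p.1.centralBinom * p.2.centralBinom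
        = (n + 1) * 4 ^ (n + 1) := by
      rw [hsymm, Finset.Nat.sum_antidiagonal_succ]
      simp only [zero_mul, zero_add, ← mul_assoc, Nat.succ_mul_centralBinom_succ]
      have : ∑ p ∈ antidiagonal n, 2 * (2 * p.1 + 1) * p.1.centralBinom * p.2.centralBinom
          = 2 * (2 * ∑ p ∈ antidiagonal n, p.1 * (p.1.centralBinom * p.2.centralBinom)
            + ∑ p ∈ antidiagonal n, p.1.centralBinom * p.2.centralBinom) := by
        rw [mul_sum, ← sum_add_distrib, mul_sum]
        exact sum_congr rfl fun p _ => by ring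
      rw [this, ← hsymm, ih]
      ring
    exact Nat.eq_of_mul_eq_mul_left n.succ_pos hrec

theorem Nat.four_pow_le_two_sqrt_mul_centralBinom {n : ℕ} (hn : 0 < n) :
    (4 : ℝ) ^ n ≤ 2 * Real.sqrt n * n.centralBinom := by
  have hsq : (16 : ℝ) ^ n ≤ 4 * n * (n.centralBinom : ℝ) ^ 2 := by
    induction n, hn using Nat.le_induction with
    | base => norm_num [Nat.centralBinom]
    | succ n hn ih =>
      have hrec : ((n : ℝ) + 1) * (n + 1).centralBinom = 2 * (2 * n + 1) * n.centralBinom := by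
        exact_mod_cast Nat.succ_mul_centralBinom_succ n
      have hn' : (0 : ℝ) < n + 1 := by positivity
      refine le_of_mul_le_mul_left ?_ hn'
      push_cast
      calc ((n : ℝ) + 1) * 16 ^ (n + 1) = 16 * (n + 1) * 16 ^ n := by ring
        _ ≤ 16 * (n + 1) * (4 * n * (n.centralBinom : ℝ) ^ 2) := by gcongr
        _ ≤ 4 * (2 * (2 * n + 1) * (n.centralBinom : ℝ)) ^ 2 := by
          nlinarith [sq_nonneg (n.centralBinom : ℝ)]
        _ = (n + 1) * (4 * (n + 1) * ((n + 1).centralBinom : ℝ) ^ 2) := by rw [← hrec]; ring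
  refine le_of_sq_le_sq ?_ (by positivity)
  rw [mul_pow, mul_pow, Real.sq_sqrt (Nat.cast_nonneg n), ← pow_mul, mul_comm n 2, pow_mul]
  norm_num
  linarith

/-- The logarithm of `(x + 1) ^ (x + 1) / (x ^ x (2 x + 1))`, half the ratio of consecutive
values of `maxLikelihoodRatio`. It is continuous at `0` because `0 * log 0 = 0`, and its
derivative is `log (1 + 1 / x) - 2 / (2 x + 1)`, the remainder of a series with positive terms. -/
theorem monotoneOn_succ_mul_log_sub_mul_log_sub_log :
    MonotoneOn (fun x : ℝ => (x + 1) * Real.log (x + 1) - x * Real.log x - Real.log (2 * x + 1))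
      (Set.Ici 0) := by
  have hderiv : ∀ x : ℝ, 0 < x → HasDerivAt
      (fun x : ℝ => (x + 1) * Real.log (x + 1) - x * Real.log x - Real.log (2 * x + 1))
      (Real.log (1 + x⁻¹) - 2 / (2 * x + 1)) x := by
    intro x hx
    have h1 := (Real.hasDerivAt_mul_log (x := x + 1) (by positivity)).comp x
      ((hasDerivAt_id x).add_const 1)
    have h2 := Real.hasDerivAt_mul_log hx.ne'
    have h3 := (((hasDerivAt_id x).const_mul 2).add_const 1).log
      (by simp only [id]; positivity)
    refine ((h1.sub h2).sub h3).congr_deriv ?_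
    have : 1 + x⁻¹ = (x + 1) / x := by field_simp
    rw [this, Real.log_div (by positivity) hx.ne']
    simp
  refine monotoneOn_of_deriv_nonneg (convex_Ici 0) ?_ ?_ ?_
  · have h := Real.continuous_mul_log
    refine ((h.comp (continuous_id.add continuous_const)).sub h).continuousOn.sub ?_
    refine ContinuousOn.log (by fun_prop) fun x hx => ?_
    have : (0 : ℝ) ≤ x := hx
    positivity
  · intro x hx
    rw [interior_Ici] at hx
    exact (hderiv x hx).differentiableAt.differentiableWithinAt
  · intro x hx
    rw [interior_Ici] at hx
    have hx' : (0 : ℝ) < x := hx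
    rw [(hderiv x hx).deriv]
    have h := Real.hasSum_log_one_add_inv hx'
    have := h.summable.sum_le_tsum {0} (fun i _ => by positivity)
    rw [h.tsum_eq] at this
    simp at this
    rw [sub_nonneg, div_eq_mul_inv]
    exact this

/-- The number `(4 k) ^ k / (k! C(2k, k))`. For `i + j = n`, the product of its values at `i`
and `j` is, up to a factor depending only on `n`, the ratio between the maximal likelihood
`C(n, i) (i / n) ^ i (j / n) ^ j` of `i` successes in `n` trials and the weight
`C(2i, i) C(2j, j) / 4 ^ n` of the discrete arcsine law. -/
noncomputable def maxLikelihoodRatio (k : ℕ) : ℝ :=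
  (k : ℝ) ^ k * 4 ^ k / (k.factorial * k.centralBinom)

theorem maxLikelihoodRatio_pos (k : ℕ) : 0 < maxLikelihoodRatio k := by
  unfold maxLikelihoodRatio
  have h1 : (0 : ℝ) < (k : ℝ) ^ k := by
    rcases Nat.eq_zero_or_pos k with rfl | h
    · simp
    · positivity
  have h2 : (0 : ℝ) < k.centralBinom := by exact_mod_cast k.centralBinom_pos
  positivity

theorem maxLikelihoodRatio_succ (k : ℕ) :
    maxLikelihoodRatio (k + 1) = maxLikelihoodRatio k *
      (2 * Real.exp (((k : ℝ) + 1) * Real.log (k + 1) - k * Real.log k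
        - Real.log (2 * k + 1))) := by
  have hpow : ∀ j : ℕ, Real.exp (j * Real.log j) = (j : ℝ) ^ j := by
    intro j
    rcases Nat.eq_zero_or_pos j with rfl | h
    · simp
    · rw [← Real.log_pow, Real.exp_log (by positivity)]
  have h1 := hpow (k + 1)
  have h0 : (0 : ℝ) < (k : ℝ) ^ k := by rw [← hpow k]; positivity
  have hrec : ((k : ℝ) + 1) * (k + 1).centralBinom = 2 * (2 * k + 1) * k.centralBinom := by
    exact_mod_cast Nat.succ_mul_centralBinom_succ k
  have hc : (0 : ℝ) < k.centralBinom := by exact_mod_cast k.centralBinom_pos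
  have hc' : (0 : ℝ) < (k + 1).centralBinom := by exact_mod_cast (k + 1).centralBinom_pos
  push_cast at h1
  rw [Real.exp_sub, Real.exp_sub, h1, hpow, Real.exp_log (by positivity)]
  unfold maxLikelihoodRatio
  have e : ((k + 1).centralBinom : ℝ) = 2 * (2 * k + 1) * k.centralBinom / (k + 1) := by
    field_simp
    linarith
  rw [e, Nat.factorial_succ]
  push_cast
  field_simp
  ring

/-- Since consecutive ratios increase and the value at `0` is `1`, `maxLikelihoodRatio` is
supermultiplicative: the comparison with the arcsine weights is worst at the endpoints. -/
theorem maxLikelihoodRatio_mul_le (i j : ℕ) :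
    maxLikelihoodRatio i * maxLikelihoodRatio j ≤ maxLikelihoodRatio (i + j) := by
  induction j with
  | zero => simp [maxLikelihoodRatio]
  | succ j ih =>
    rw [← add_assoc, maxLikelihoodRatio_succ, maxLikelihoodRatio_succ, ← mul_assoc]
    have hmono := monotoneOn_succ_mul_log_sub_mul_log_sub_log
      (Set.mem_Ici.mpr (Nat.cast_nonneg j)) (Set.mem_Ici.mpr (Nat.cast_nonneg (i + j)))
      (by exact_mod_cast Nat.le_add_left j i)
    have := maxLikelihoodRatio_pos (i + j)
    gcongr

theorem sum_choose_mul_maxLikelihood_le {n : ℕ} (hn : 0 < n) :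
    ∑ k ∈ Finset.range (n + 1),
      (n.choose k : ℝ) * (((k : ℝ) / n) ^ k * (1 - (k : ℝ) / n) ^ (n - k))
      ≤ 2 * Real.sqrt n := by
  have hn0 : (0 : ℝ) < n := by exact_mod_cast hn
  have hcn : (0 : ℝ) < n.centralBinom := by exact_mod_cast n.centralBinom_pos
  have hterm : ∀ p ∈ Finset.HasAntidiagonal.antidiagonal n,
      (n.choose p.1 : ℝ) * (((p.1 : ℝ) / n) ^ p.1 * (1 - (p.1 : ℝ) / n) ^ p.2)
        ≤ (p.1.centralBinom * p.2.centralBinom : ℕ) / n.centralBinom := by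
    rintro ⟨i, j⟩ hp
    obtain rfl : i + j = n := Finset.HasAntidiagonal.mem_antidiagonal.mp hp
    simp only
    have e1 : 1 - (i : ℝ) / (i + j : ℕ) = j / (i + j : ℕ) := by
      field_simp; push_cast; ring
    have hi : (0 : ℝ) < i.centralBinom := by exact_mod_cast i.centralBinom_pos
    have hj : (0 : ℝ) < j.centralBinom := by exact_mod_cast j.centralBinom_pos
    have hle := maxLikelihoodRatio_mul_le i j
    unfold maxLikelihoodRatio at hle
    have hcoef : 0 ≤ ((i + j).factorial * (i.centralBinom * j.centralBinom) : ℝ)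
        / (((i + j : ℕ) : ℝ) ^ (i + j) * 4 ^ (i + j)) := by positivity
    have h := mul_le_mul_of_nonneg_left hle hcoef
    have hchoose : ((i + j).choose i : ℝ) = (i + j).factorial / (i.factorial * j.factorial) := by
      rw [eq_div_iff (by positivity), ← mul_assoc]
      rw [Nat.choose_symm_add]
      exact_mod_cast Nat.add_choose_mul_factorial_mul_factorial i j
    rw [e1, hchoose]
    have hpowN : (((i + j : ℕ) : ℝ)) ^ (i + j) = ((i + j : ℕ) : ℝ) ^ i * ((i + j : ℕ) : ℝ) ^ j :=
      pow_add _ _ _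
    have hpow4 : (4 : ℝ) ^ (i + j) = 4 ^ i * 4 ^ j := pow_add _ _ _
    rw [hpowN, hpow4] at h
    generalize i + j = N at h hn0 hcn ⊢
    refine Eq.trans_le ?_ (h.trans_eq ?_)
    · rw [div_pow, div_pow]
      field_simp
    · push_cast
      field_simp
  rw [← Finset.Nat.sum_antidiagonal_eq_sum_range_succ
    (fun i j => (n.choose i : ℝ) * (((i : ℝ) / n) ^ i * (1 - (i : ℝ) / n) ^ j))]
  calc _ ≤ ∑ p ∈ Finset.HasAntidiagonal.antidiagonal n,
        ((p.1.centralBinom * p.2.centralBinom : ℕ) : ℝ) / n.centralBinom := Finset.sum_le_sum hterm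
    _ = 4 ^ n / n.centralBinom := by
      rw [← Finset.sum_div, ← Nat.cast_sum, Nat.sum_antidiagonal_centralBinom_mul]
      push_cast; rfl
    _ ≤ _ := by
      rw [div_le_iff₀ hcn]
      exact Nat.four_pow_le_two_sqrt_mul_centralBinom hn

/-! ### Change of measure -/

/-- The Donsker–Varadhan inequality: the Kullback–Leibler divergence from `μ` to the tilted measure
`ν.tilted g` is nonnegative. -/
theorem ofReal_integral_sub_log_integral_exp_le_klDiv {Ω : Type*} [MeasurableSpace Ω]
    (μ ν : Measure Ω) [IsProbabilityMeasure μ] [IsProbabilityMeasure ν] {g : Ω → ℝ}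
    (hg : Measurable g) {C : ℝ} (hC : ∀ ω, |g ω| ≤ C) :
    ENNReal.ofReal (∫ ω, g ω ∂μ - Real.log (∫ ω, Real.exp (g ω) ∂ν)) ≤ klDiv μ ν := by
  by_cases htop : klDiv μ ν = ∞
  · rw [htop]; exact le_top
  obtain ⟨hac, hllr⟩ := klDiv_ne_top_iff.mp htop
  have hgμ : Integrable g μ := .of_bound hg.aestronglyMeasurable C (ae_of_all _ hC)
  have hexp : Integrable (fun ω => Real.exp (g ω)) ν := by
    refine .of_bound hg.exp.aestronglyMeasurable (Real.exp C) (ae_of_all _ fun ω => ?_)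
    rw [Real.norm_eq_abs, Real.abs_exp, Real.exp_le_exp]
    exact (abs_le.mp (hC ω)).2
  rw [← ENNReal.ofReal_toReal htop, toReal_klDiv_of_measure_eq hac (by simp)]
  refine ENNReal.ofReal_le_ofReal ?_
  have : IsProbabilityMeasure (ν.tilted g) := isProbabilityMeasure_tilted hexp
  have hac' : μ ≪ ν.tilted g := hac.trans (absolutelyContinuous_tilted hexp)
  have hnn := integral_llr_add_sub_measure_univ_nonneg hac'
    (integrable_llr_tilted_right hac hgμ hllr hexp)
  rw [integral_llr_tilted_right hac hgμ hexp hllr] at hnn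
  simp only [probReal_univ] at hnn
  linarith

/-! ### Exponential moments of averages -/

/-- A convex function of `∑ xᵢ` on the cube is at most the mean of its values at the vertices,
where the vertex `t` has the probability given by independent Bernoulli coordinates with means
`xᵢ`. -/
theorem ConvexOn.apply_add_sum_le_sum_powerset {ι : Type*} [DecidableEq ι] {φ : ℝ → ℝ}
    (hφ : ConvexOn ℝ Set.univ φ) {x : ι → ℝ} (hx : ∀ i, x i ∈ Set.Icc (0 : ℝ) 1)
    (s : Finset ι) (c : ℝ) :
    φ (c + ∑ i ∈ s, x i) ≤ ∑ t ∈ s.powerset,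
      ((∏ i ∈ t, x i) * ∏ i ∈ s \ t, (1 - x i)) * φ (c + t.card) := by
  induction s using Finset.induction_on generalizing c with
  | empty => simp
  | insert a s ha ih =>
    obtain ⟨h0, h1⟩ := hx a
    have hconv : φ (c + ∑ i ∈ insert a s, x i) ≤
        (1 - x a) * φ (c + ∑ i ∈ s, x i) + x a * φ (c + 1 + ∑ i ∈ s, x i) := by
      rw [Finset.sum_insert ha]
      have := hφ.2 (Set.mem_univ (c + ∑ i ∈ s, x i)) (Set.mem_univ (c + 1 + ∑ i ∈ s, x i))
        (sub_nonneg.mpr h1) h0 (by ring)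
      simp only [smul_eq_mul] at this
      have e : c + (x a + ∑ i ∈ s, x i)
          = (1 - x a) * (c + ∑ i ∈ s, x i) + x a * (c + 1 + ∑ i ∈ s, x i) := by ring
      rwa [e]
    refine hconv.trans ((add_le_add (mul_le_mul_of_nonneg_left (ih c) (sub_nonneg.mpr h1))
      (mul_le_mul_of_nonneg_left (ih (c + 1)) h0)).trans_eq ?_)
    rw [Finset.sum_powerset_insert ha, Finset.mul_sum, Finset.mul_sum]
    congr 1
    · refine Finset.sum_congr rfl fun t ht => ?_
      have hat : a ∉ t := fun h => ha (Finset.mem_powerset.mp ht h)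
      rw [Finset.insert_sdiff_of_notMem _ hat, Finset.prod_insert (by simp [ha])]
      ring
    · refine Finset.sum_congr rfl fun t ht => ?_
      have hat : a ∉ t := fun h => ha (Finset.mem_powerset.mp ht h)
      rw [Finset.prod_insert hat, Finset.insert_sdiff_insert, Finset.card_insert_of_notMem hat,
        Finset.sdiff_insert_of_notMem ha]
      push_cast
      rw [add_assoc c 1, add_comm (1 : ℝ)]
      ring

theorem convexOn_exp_mul_sq_sub_div {a : ℝ} (ha : 0 ≤ a) (p b : ℝ) :
    ConvexOn ℝ Set.univ (fun x : ℝ => Real.exp (a * (p - x / b) ^ 2)) := by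
  refine ⟨convex_univ, fun x _ y _ u v hu hv huv => ?_⟩
  refine le_trans ?_ (convexOn_exp.2 (Set.mem_univ _) (Set.mem_univ _) hu hv huv)
  simp only [smul_eq_mul, Real.exp_le_exp]
  obtain rfl : v = 1 - u := by linarith
  have h : 0 ≤ a * (u * (1 - u) * (x / b - y / b) ^ 2) := by positivity
  have e : (u * x + (1 - u) * y) / b = u * (x / b) + (1 - u) * (y / b) := by ring
  rw [e]
  nlinarith

/-- Hoeffding's lemma for a Bernoulli variable. -/
theorem one_sub_add_mul_exp_le {p : ℝ} (hp : p ∈ Set.Icc (0 : ℝ) 1) (t : ℝ) :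
    1 - p + p * Real.exp t ≤ Real.exp (t * p + t ^ 2 / 8) := by
  obtain ⟨h0, h1⟩ := hp
  set μ : Measure ℝ := ENNReal.ofReal (1 - p) • Measure.dirac 0 + ENNReal.ofReal p • Measure.dirac 1
    with hμ
  have hint : ∀ f : ℝ → ℝ, Measurable f → ∫ x, f x ∂μ = (1 - p) * f 0 + p * f 1 := by
    intro f hf
    have hi : ∀ a : ℝ, Integrable f (Measure.dirac a) := fun a =>
      integrable_dirac (by simp)
    rw [hμ, integral_add_measure ((hi 0).smul_measure ENNReal.ofReal_ne_top)
      ((hi 1).smul_measure ENNReal.ofReal_ne_top), integral_smul_measure, integral_smul_measure,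
      integral_dirac, integral_dirac, ENNReal.toReal_ofReal h0,
      ENNReal.toReal_ofReal (sub_nonneg.mpr h1), smul_eq_mul, smul_eq_mul]
  have : IsProbabilityMeasure μ := ⟨by
    simp [hμ, ← ENNReal.ofReal_add (sub_nonneg.mpr h1) h0]⟩
  have hsupp : ∀ᵐ x ∂μ, x ∈ Set.Icc (0 : ℝ) 1 := by
    rw [hμ, ae_add_measure_iff]
    exact ⟨Measure.ae_smul_measure (by simp [ae_dirac_eq]) _,
      Measure.ae_smul_measure (by simp [ae_dirac_eq]) _⟩
  have h := (hasSubgaussianMGF_of_mem_Icc (X := id) aemeasurable_id hsupp).mgf_le t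
  simp only [mgf, id] at h
  rw [hint (fun x => x) measurable_id, hint _ (by fun_prop)] at h
  simp only [mul_zero, mul_one, zero_add] at h
  have key : 1 - p + p * Real.exp t = Real.exp (t * p) *
      ((1 - p) * Real.exp (t * (0 - p)) + p * Real.exp (t * (1 - p))) := by
    rw [mul_add, mul_left_comm, ← Real.exp_add, mul_left_comm (Real.exp (t * p)), ← Real.exp_add]
    have e0 : t * p + t * (0 - p) = 0 := by ring
    have e1 : t * p + t * (1 - p) = t := by ring
    rw [e0, e1, Real.exp_zero, mul_one]
  rw [key, Real.exp_add]
  refine mul_le_mul_of_nonneg_left (h.trans_eq ?_) (Real.exp_pos _).le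
  congr 1
  norm_num
  ring

/-- Pinsker's inequality for Bernoulli distributions with means `k / n` and `p`, in exponential
form. -/
theorem pow_mul_pow_mul_exp_le {n k : ℕ} (hn : 0 < n) (hk : k ≤ n) {p : ℝ}
    (hp : p ∈ Set.Icc (0 : ℝ) 1) :
    p ^ k * (1 - p) ^ (n - k) * Real.exp (2 * n * (p - k / n) ^ 2)
      ≤ ((k : ℝ) / n) ^ k * (1 - (k : ℝ) / n) ^ (n - k) := by
  obtain ⟨h0, h1⟩ := hp
  have h1' : 0 ≤ 1 - p := sub_nonneg.mpr h1
  have hn0 : (0 : ℝ) < n := by exact_mod_cast hn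
  set q : ℝ := k / n with hq
  have hq0 : 0 ≤ q := by positivity
  have hq1 : 0 ≤ 1 - q := by
    rw [sub_nonneg, hq, div_le_one hn0]; exact_mod_cast hk
  have hkq : q * n = k := by rw [hq]; field_simp
  have hkq' : (1 - q) * n = (n - k : ℕ) := by rw [Nat.cast_sub hk, ← hkq]; ring
  -- The slope at which Hoeffding's lemma is tight enough to give the quadratic term.
  set t : ℝ := 4 * (q - p) with ht
  have hA : 0 ≤ p * Real.exp t / q := by positivity
  have hB : 0 ≤ (1 - p) / (1 - q) := by positivity
  have hamgm := Real.geom_mean_le_arith_mean2_weighted hq0 hq1 hA hB (by ring)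
  have hle : q * (p * Real.exp t / q) + (1 - q) * ((1 - p) / (1 - q))
      ≤ Real.exp (t * p + t ^ 2 / 8) := by
    refine le_trans ?_ (one_sub_add_mul_exp_le ⟨h0, h1⟩ t)
    have hcancel : ∀ a b : ℝ, 0 ≤ b → a * (b / a) ≤ b := fun a b hb => by
      rcases eq_or_ne a 0 with rfl | ha
      · simpa using hb
      · rw [mul_div_cancel₀ _ ha]
    linarith [hcancel q (p * Real.exp t) (by positivity), hcancel (1 - q) (1 - p) h1']
  have hpow := pow_le_pow_left₀ (by positivity) (hamgm.trans hle) n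
  rw [mul_pow, ← Real.rpow_natCast, ← Real.rpow_natCast, ← Real.rpow_mul hA, ← Real.rpow_mul hB,
    hkq, hkq', Real.rpow_natCast, Real.rpow_natCast, ← Real.exp_nat_mul] at hpow
  have hAk : (p * Real.exp t / q) ^ k * q ^ k = p ^ k * Real.exp (k * t) := by
    rcases Nat.eq_zero_or_pos k with rfl | hk0
    · simp
    · have : q ≠ 0 := by rw [hq]; positivity
      rw [← mul_pow, div_mul_cancel₀ _ this, mul_pow, Real.exp_nat_mul]
  have hBk : ((1 - p) / (1 - q)) ^ (n - k) * (1 - q) ^ (n - k) = (1 - p) ^ (n - k) := by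
    rcases Nat.eq_zero_or_pos (n - k) with h | hk0
    · simp [h]
    · have : 1 - q ≠ 0 := by
        intro h
        rw [h, zero_mul] at hkq'
        exact hk0.ne' (by exact_mod_cast hkq'.symm)
      rw [← mul_pow, div_mul_cancel₀ _ this]
  have hfin := mul_le_mul_of_nonneg_right hpow
    (mul_nonneg (pow_nonneg hq0 k) (pow_nonneg hq1 (n - k)))
  have hexp : Real.exp (k * t) =
      Real.exp (2 * n * (p - q) ^ 2) * Real.exp (n * (t * p + t ^ 2 / 8)) := by
    rw [← Real.exp_add, ← hkq, ht]
    congr 1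
    ring
  have hlhs : (p * Real.exp t / q) ^ k * ((1 - p) / (1 - q)) ^ (n - k)
      * (q ^ k * (1 - q) ^ (n - k)) =
      Real.exp (n * (t * p + t ^ 2 / 8)) *
        (p ^ k * (1 - p) ^ (n - k) * Real.exp (2 * n * (p - q) ^ 2)) := by
    calc _ = ((p * Real.exp t / q) ^ k * q ^ k)
          * (((1 - p) / (1 - q)) ^ (n - k) * (1 - q) ^ (n - k)) := by ring
      _ = _ := by rw [hAk, hBk, hexp]; ring
  rw [hlhs] at hfin
  exact le_of_mul_le_mul_left hfin (Real.exp_pos _)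

/-- Maurer's bound for i.i.d. variables with values in `[0, 1]`: after the reduction to
Bernoulli variables and Pinsker's inequality, nothing depends on the law of `X` any more. -/
theorem integral_exp_two_mul_sq_sub_mean_le {Ω : Type*} [MeasurableSpace Ω] (μ : Measure Ω)
    [IsProbabilityMeasure μ] {X : Ω → ℝ} (hX : Measurable X)
    (hX01 : ∀ ω, X ω ∈ Set.Icc (0 : ℝ) 1) {n : ℕ} (hn : 0 < n) :
    ∫ ω : Fin n → Ω, Real.exp (2 * n * (∫ x, X x ∂μ - (∑ i, X (ω i)) / n) ^ 2)
      ∂(Measure.pi fun _ => μ) ≤ 2 * Real.sqrt n := by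
  set p := ∫ x, X x ∂μ with hp
  have hXi : Integrable X μ := .of_mem_Icc 0 1 hX.aemeasurable (ae_of_all _ hX01)
  have hp01 : p ∈ Set.Icc (0 : ℝ) 1 := by
    refine ⟨integral_nonneg fun ω => (hX01 ω).1, ?_⟩
    have := integral_mono hXi (integrable_const 1) fun ω => (hX01 ω).2
    simpa using this
  set φ : ℝ → ℝ := fun x => Real.exp (2 * n * (p - x / n) ^ 2) with hφ
  have hφc : ConvexOn ℝ Set.univ φ := convexOn_exp_mul_sq_sub_div (by positivity) p n
  -- The weight of the vertex of the cube given by `t`, as a product over the coordinates.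
  set w : Finset (Fin n) → Fin n → Ω → ℝ := fun t i ω => if i ∈ t then X ω else 1 - X ω with hw
  have hwm : ∀ t i, Measurable (w t i) := fun t i => by
    simp only [hw]; split_ifs <;> fun_prop
  have hw01 : ∀ t i ω, w t i ω ∈ Set.Icc (0 : ℝ) 1 := fun t i ω => by
    obtain ⟨h0, h1⟩ := hX01 ω
    simp only [hw]; split_ifs <;> constructor <;> linarith
  have hwint : ∀ t : Finset (Fin n), ∫ ω : Fin n → Ω, ∏ i, w t i (ω i) ∂(Measure.pi fun _ => μ)
      = p ^ t.card * (1 - p) ^ (n - t.card) := by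
    intro t
    rw [integral_fintype_prod_eq_prod]
    have : ∀ i, ∫ x, w t i x ∂μ = if i ∈ t then p else 1 - p := by
      intro i
      simp only [hw]
      split_ifs
      · rfl
      · rw [integral_sub (integrable_const _) hXi]; simp [hp]
    simp_rw [this]
    rw [Finset.prod_ite]
    simp [Finset.filter_not, Finset.card_sdiff_of_subset]
  have hwi : ∀ t : Finset (Fin n), Integrable (fun ω : Fin n → Ω => ∏ i, w t i (ω i))
      (Measure.pi fun _ => μ) := by
    intro t
    refine .of_mem_Icc 0 1 (Finset.measurable_prod _ fun i _ =>
      (hwm t i).comp (measurable_pi_apply i)).aemeasurable (ae_of_all _ fun ω => ?_)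
    exact ⟨Finset.prod_nonneg fun i _ => (hw01 t i _).1,
      Finset.prod_le_one (fun i _ => (hw01 t i _).1) fun i _ => (hw01 t i _).2⟩
  have hpt : ∀ ω : Fin n → Ω, φ (∑ i, X (ω i)) ≤
      ∑ t ∈ Finset.univ.powerset, (∏ i, w t i (ω i)) * φ t.card := by
    intro ω
    have := hφc.apply_add_sum_le_sum_powerset (fun i => hX01 (ω i)) Finset.univ 0
    simp only [zero_add] at this
    refine this.trans_eq (Finset.sum_congr rfl fun t _ => ?_)
    simp only [hw, Finset.prod_ite]
    congr 3
    · ext; simp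
    · ext; simp
  calc ∫ ω : Fin n → Ω, φ (∑ i, X (ω i)) ∂(Measure.pi fun _ => μ)
      ≤ ∫ ω : Fin n → Ω, ∑ t ∈ Finset.univ.powerset, (∏ i, w t i (ω i)) * φ t.card
          ∂(Measure.pi fun _ => μ) :=
        integral_mono_of_nonneg (ae_of_all _ fun ω => (Real.exp_pos _).le)
          (integrable_finsetSum _ fun t _ => (hwi t).mul_const _) (ae_of_all _ hpt)
    _ = ∑ t ∈ (Finset.univ : Finset (Fin n)).powerset,
          p ^ t.card * (1 - p) ^ (n - t.card) * φ t.card := by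
        rw [integral_finsetSum _ fun t _ => (hwi t).mul_const _]
        exact Finset.sum_congr rfl fun t _ => by rw [integral_mul_const, hwint]
    _ = ∑ k ∈ Finset.range (n + 1),
          (n.choose k : ℝ) * (p ^ k * (1 - p) ^ (n - k) * φ k) := by
        rw [Finset.sum_powerset_apply_card (fun k => p ^ k * (1 - p) ^ (n - k) * φ k)]
        simp
    _ ≤ ∑ k ∈ Finset.range (n + 1),
          (n.choose k : ℝ) * (((k : ℝ) / n) ^ k * (1 - (k : ℝ) / n) ^ (n - k)) := by
        refine Finset.sum_le_sum fun k hk => mul_le_mul_of_nonneg_left ?_ (Nat.cast_nonneg _)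
        exact pow_mul_pow_mul_exp_le hn (Finset.mem_range_succ_iff.mp hk) hp01
    _ ≤ 2 * Real.sqrt n := sum_choose_mul_maxLikelihood_le hn

theorem integral_exp_mul_sum_sub_le {Ω : Type*} [MeasurableSpace Ω] (μ : Measure Ω)
    [IsProbabilityMeasure μ] {X : Ω → ℝ} (hX : Measurable X)
    (hX01 : ∀ ω, X ω ∈ Set.Icc (0 : ℝ) 1) (m : ℕ) (s : ℝ) :
    ∫ ω : Fin m → Ω, Real.exp (s * ∑ j, (∫ x, X x ∂μ - X (ω j))) ∂(Measure.pi fun _ => μ)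
      ≤ Real.exp (m * (s ^ 2 / 8)) := by
  simp_rw [Finset.mul_sum, Real.exp_sum]
  rw [integral_fintype_prod_eq_prod (f := fun _ x => Real.exp (s * (∫ x, X x ∂μ - X x))),
    Finset.prod_const, Finset.card_univ, Fintype.card_fin, Real.exp_nat_mul]
  refine pow_le_pow_left₀ (integral_nonneg fun ω => (Real.exp_pos _).le) ?_ m
  have h := (hasSubgaussianMGF_of_mem_Icc hX.aemeasurable (ae_of_all μ hX01)).mgf_le (-s)
  simp only [mgf] at h
  calc _ = ∫ x, Real.exp (-s * (X x - ∫ x, X x ∂μ)) ∂μ := by congr 1; ext x; congr 1; ring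
    _ ≤ _ := h
    _ = _ := by congr 1; norm_num; ring

/-! ### Auxiliary facts on integrals and square roots -/

theorem Measurable.integral_probabilityMeasure {α Ω : Type*} [MeasurableSpace α]
    [MeasurableSpace Ω] {g : α → ProbabilityMeasure Ω} (hg : Measurable g) {f : α → Ω → ℝ}
    (hf : Measurable (Function.uncurry f)) :
    Measurable fun a => ∫ x, f a x ∂(g a : Measure Ω) := by
  let κ : Kernel α Ω := ⟨fun a => (g a : Measure Ω), measurable_subtype_coe.comp hg⟩
  have : IsMarkovKernel κ := ⟨fun a => inferInstanceAs (IsProbabilityMeasure (g a : Measure Ω))⟩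
  exact (hf.stronglyMeasurable.integral_kernel_prod_right (κ := κ)).measurable

theorem integral_mem_Icc_zero_one {Ω : Type*} [MeasurableSpace Ω] (μ : Measure Ω)
    [IsProbabilityMeasure μ] {X : Ω → ℝ} (hX : Measurable X)
    (hX01 : ∀ ω, X ω ∈ Set.Icc (0 : ℝ) 1) : ∫ ω, X ω ∂μ ∈ Set.Icc (0 : ℝ) 1 := by
  refine ⟨integral_nonneg fun ω => (hX01 ω).1, ?_⟩
  have := integral_mono (Integrable.of_mem_Icc 0 1 hX.aemeasurable (ae_of_all μ hX01))
    (integrable_const 1) fun ω => (hX01 ω).2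
  simpa using this

theorem ofReal_integral_le_lintegral_ofReal {Ω : Type*} [MeasurableSpace Ω] {μ : Measure Ω}
    {f : Ω → ℝ} (hf : Integrable f μ) :
    ENNReal.ofReal (∫ ω, f ω ∂μ) ≤ ∫⁻ ω, ENNReal.ofReal (f ω) ∂μ := by
  rw [integral_eq_lintegral_pos_part_sub_lintegral_neg_part hf]
  exact (ENNReal.ofReal_le_ofReal (sub_le_self _ ENNReal.toReal_nonneg)).trans
    ENNReal.ofReal_toReal_le

theorem sq_integral_le_integral_sq {Ω : Type*} [MeasurableSpace Ω] (μ : Measure Ω)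
    [IsProbabilityMeasure μ] {Y : Ω → ℝ} (hY : Integrable Y μ)
    (hY2 : Integrable (fun ω => Y ω ^ 2) μ) : (∫ ω, Y ω ∂μ) ^ 2 ≤ ∫ ω, Y ω ^ 2 ∂μ := by
  set y := ∫ ω, Y ω ∂μ with hy
  have h := integral_mono (((hY.const_mul (2 * y)).sub (integrable_const (y ^ 2)))) hY2
    fun ω => by
      simp only [Pi.sub_apply]
      nlinarith [sq_nonneg (Y ω - y)]
  simp only [Pi.sub_apply] at h
  rw [integral_sub (hY.const_mul _) (integrable_const _), integral_const_mul, ← hy] at h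
  simp at h
  linarith

/-- Markov's inequality for the complementary event. -/
theorem one_sub_le_measureReal_lt_of_integral_le {Ω : Type*} [MeasurableSpace Ω] (μ : Measure Ω)
    [IsProbabilityMeasure μ] {H : Ω → ℝ} (hH : Measurable H) (hHi : Integrable H μ)
    (hH0 : ∀ ω, 0 ≤ H ω) {c δ : ℝ} (hc : 0 < c) (hδ : 0 < δ) (hle : ∫ ω, H ω ∂μ ≤ c) :
    1 - δ ≤ μ.real {ω | H ω < c / δ} := by
  have hM := mul_meas_ge_le_integral_of_nonneg (ae_of_all μ hH0) hHi (c / δ)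
  have hcompl : {ω | H ω < c / δ} = {ω | c / δ ≤ H ω}ᶜ := by ext; simp
  rw [hcompl, probReal_compl_eq_one_sub (measurableSet_le measurable_const hH)]
  have : c / δ * μ.real {ω | c / δ ≤ H ω} ≤ c / δ * δ := by
    rw [div_mul_cancel₀ _ hδ.ne']; exact hM.trans hle
  have := le_of_mul_le_mul_left this (by positivity)
  linarith

/-- The square root of a possibly infinite bound on `N x²`, which is needed only where `x` is
nonnegative. -/
theorem ofReal_le_div_rpow_half {N : ℝ≥0∞} (hN0 : N ≠ 0) (hNtop : N ≠ ∞) {x : ℝ} {C : ℝ≥0∞}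
    (h : 0 ≤ x → ENNReal.ofReal (N.toReal * x ^ 2) ≤ C) :
    ENNReal.ofReal x ≤ (C / N) ^ (1 / 2 : ℝ) := by
  rcases lt_or_ge x 0 with hx | hx
  · rw [ENNReal.ofReal_of_nonpos hx.le]; exact zero_le
  · have h2 : ENNReal.ofReal (x ^ 2) ≤ C / N := by
      rw [ENNReal.le_div_iff_mul_le (.inl hN0) (.inl hNtop), mul_comm]
      have := h hx
      rwa [ENNReal.ofReal_mul ENNReal.toReal_nonneg, ENNReal.ofReal_toReal hNtop] at this
    refine le_trans (le_of_eq ?_) (ENNReal.rpow_le_rpow h2 (by norm_num))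
    rw [ENNReal.ofReal_rpow_of_nonneg (sq_nonneg x) (by norm_num), ← Real.sqrt_eq_rpow,
      Real.sqrt_sq hx]

/-- Some tangent to `x ↦ 2 N x²` at a point of the grid `{0, 1 / N, …, 1}` is within `1` of the
parabola at `x`. -/
theorem exists_nat_le_two_mul_sq_sub_div_le {N : ℕ} (hN : 0 < N) {x : ℝ} (hx0 : 0 ≤ x)
    (hx1 : x ≤ 1) : ∃ k ∈ Finset.range (N + 1), 2 * (N : ℝ) * (x - k / N) ^ 2 ≤ 1 := by
  have hN1 : (1 : ℝ) ≤ N := by exact_mod_cast hN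
  have hnn : 0 ≤ N * x + 1 / 2 := by positivity
  refine ⟨⌊N * x + 1 / 2⌋₊, ?_, ?_⟩
  · rw [Finset.mem_range, Nat.floor_lt hnn]
    push_cast
    nlinarith
  · have h1 := Nat.floor_le hnn
    have h2 := Nat.lt_floor_add_one (N * x + 1 / 2)
    set k : ℝ := (⌊N * x + 1 / 2⌋₊ : ℝ)
    have e : 2 * (N : ℝ) * (x - k / N) ^ 2 = 2 * (N * x - k) ^ 2 / N := by field_simp
    rw [e, div_le_iff₀ (by linarith)]
    nlinarith

theorem ENNReal.ofReal_sum_le {ι : Type*} (s : Finset ι) (f : ι → ℝ) :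
    ENNReal.ofReal (∑ i ∈ s, f i) ≤ ∑ i ∈ s, ENNReal.ofReal (f i) :=
  Finset.le_sum_of_subadditive ENNReal.ofReal ENNReal.ofReal_zero.le
    (fun _ _ => ENNReal.ofReal_add_le) s f

/-! ### Two-level change of measure -/

theorem abs_log_integral_exp_le {Ω : Type*} [MeasurableSpace Ω] (μ : Measure Ω)
    [IsProbabilityMeasure μ] {g : Ω → ℝ} (hg : Measurable g) {C : ℝ} (hC : ∀ ω, |g ω| ≤ C) :
    |Real.log (∫ ω, Real.exp (g ω) ∂μ)| ≤ C ∧ 0 < ∫ ω, Real.exp (g ω) ∂μ := by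
  have hmem : ∀ ω, Real.exp (g ω) ∈ Set.Icc (Real.exp (-C)) (Real.exp C) := fun ω =>
    ⟨Real.exp_le_exp.mpr (abs_le.mp (hC ω)).1, Real.exp_le_exp.mpr (abs_le.mp (hC ω)).2⟩
  have hi : Integrable (fun ω => Real.exp (g ω)) μ :=
    .of_mem_Icc _ _ hg.exp.aemeasurable (ae_of_all _ hmem)
  have hlo := integral_mono (integrable_const (Real.exp (-C))) hi fun ω => (hmem ω).1
  have hhi := integral_mono hi (integrable_const (Real.exp C)) fun ω => (hmem ω).2
  simp only [integral_const, probReal_univ, one_smul] at hlo hhi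
  have hpos := (Real.exp_pos (-C)).trans_le hlo
  exact ⟨abs_le.mpr ⟨(Real.le_log_iff_exp_le hpos).mpr hlo, (Real.log_le_iff_le_exp hpos).mpr hhi⟩,
    hpos⟩

/-- The product of the moments of `g i` under `P`, as the exponential of a bounded measurable
function of `P`. -/
theorem exists_prod_integral_exp_eq_exp {F ι : Type*} [MeasurableSpace F] [Fintype ι]
    {g : ι → F → ℝ} (hg : ∀ i, Measurable (g i)) {C : ℝ} (hC : ∀ i f, |g i f| ≤ C) :
    ∃ u : ProbabilityMeasure F → ℝ, Measurable u ∧ (∀ P, |u P| ≤ Fintype.card ι * C) ∧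
      (∀ P, u P = ∑ i, Real.log (∫ f, Real.exp (g i f) ∂(P : Measure F))) ∧
      ∀ P : ProbabilityMeasure F,
        ∏ i, ∫ f, Real.exp (g i f) ∂(P : Measure F) = Real.exp (u P) := by
  refine ⟨fun P => ∑ i, Real.log (∫ f, Real.exp (g i f) ∂(P : Measure F)),
    Finset.measurable_sum _ fun i _ => Real.measurable_log.comp ?_, fun P => ?_, fun P => rfl,
    fun P => ?_⟩
  · exact measurable_id.integral_probabilityMeasure (f := fun _ f => Real.exp (g i f))
      ((hg i).exp.comp measurable_snd)
  · exact (Finset.abs_sum_le_sum_abs _ _).trans ((Finset.sum_le_card_nsmul _ _ C fun i _ =>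
      (abs_log_integral_exp_le _ (hg i) (hC i)).1).trans_eq (by simp))
  · rw [Real.exp_sum]
    exact Finset.prod_congr rfl fun i _ =>
      (Real.exp_log (abs_log_integral_exp_le _ (hg i) (hC i)).2).symm

theorem integral_prod_integral_exp_pos {F ι : Type*} [MeasurableSpace F] [Fintype ι]
    (hyperPrior : MetaLearning.HyperDistribution F)
    {g : ι → F → ℝ} (hg : ∀ i, Measurable (g i)) {C : ℝ} (hC : ∀ i f, |g i f| ≤ C) :
    0 < ∫ P, ∏ i, ∫ f, Real.exp (g i f) ∂(P : Measure F)
      ∂(hyperPrior : Measure (ProbabilityMeasure F)) := by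
  obtain ⟨u, hum, hub, -, hexp⟩ := exists_prod_integral_exp_eq_exp hg hC
  simp_rw [hexp]
  exact (abs_log_integral_exp_le _ hum hub).2

/-- Donsker–Varadhan applied to each `Q i` against `P`, and then to the hyper-distributions of
`P`. The function `P ↦ KL(Q i ‖ P)` need not be measurable, but it is bounded below by a
measurable one. -/
theorem ofReal_sum_integral_sub_log_integral_prod_le {F ι : Type*} [MeasurableSpace F] [Fintype ι]
    (hyperPost hyperPrior : MetaLearning.HyperDistribution F) (Q : ι → ProbabilityMeasure F)
    {g : ι → F → ℝ} (hg : ∀ i, Measurable (g i)) {C : ℝ} (hC : ∀ i f, |g i f| ≤ C) :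
    ENNReal.ofReal (∑ i, ∫ f, g i f ∂(Q i : Measure F) -
        Real.log (∫ P, ∏ i, ∫ f, Real.exp (g i f) ∂(P : Measure F)
          ∂(hyperPrior : Measure (ProbabilityMeasure F)))) ≤
      klDiv (hyperPost : Measure (ProbabilityMeasure F))
          (hyperPrior : Measure (ProbabilityMeasure F)) +
        ∫⁻ P, ∑ i, klDiv (Q i : Measure F) (P : Measure F)
          ∂(hyperPost : Measure (ProbabilityMeasure F)) := by
  set c := ∑ i, ∫ f, g i f ∂(Q i : Measure F) with hc
  obtain ⟨u, hum, hub, hu, hexp⟩ := exists_prod_integral_exp_eq_exp hg hC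
  simp_rw [hexp]
  have hui : Integrable u (hyperPost : Measure (ProbabilityMeasure F)) :=
    .of_bound hum.aestronglyMeasurable _ (ae_of_all _ hub)
  have hsplit : c - Real.log (∫ P, Real.exp (u P) ∂(hyperPrior : Measure (ProbabilityMeasure F)))
      = (∫ P, u P ∂(hyperPost : Measure (ProbabilityMeasure F))
          - Real.log (∫ P, Real.exp (u P) ∂(hyperPrior : Measure (ProbabilityMeasure F))))
        + ∫ P, (c - u P) ∂(hyperPost : Measure (ProbabilityMeasure F)) := by
    rw [integral_sub (integrable_const _) hui]
    simp
  rw [hsplit]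
  refine ENNReal.ofReal_add_le.trans (add_le_add
    (ofReal_integral_sub_log_integral_exp_le_klDiv _ _ hum hub) ?_)
  refine (ofReal_integral_le_lintegral_ofReal ((integrable_const c).sub hui)).trans
    (lintegral_mono fun P => ?_)
  simp only [Pi.sub_apply]
  rw [hc, hu, ← Finset.sum_sub_distrib]
  exact (ENNReal.ofReal_sum_le _ _).trans (Finset.sum_le_sum fun i _ =>
    ofReal_integral_sub_log_integral_exp_le_klDiv _ _ (hg i) (hC i))

/-! ### Deviations between tasks -/

/-- The gap between the mean of `X A` under the task law `μ` and its average over the `n` sampled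
tasks `t`. -/
noncomputable def taskGap {𝒜 T : Type*} [MeasurableSpace T] {n : ℕ} (X : 𝒜 → T → ℝ)
    (μ : Measure T) (A : 𝒜) (t : Fin n → T) : ℝ :=
  ∫ x, X A x ∂μ - (∑ i, X A (t i)) / n

theorem measurable_uncurry_taskGap {𝒜 T : Type*} [MeasurableSpace 𝒜] [MeasurableSpace T] {n : ℕ}
    {X : 𝒜 → T → ℝ} (hX : Measurable (Function.uncurry X)) (μ : Measure T) [SFinite μ] :
    Measurable (Function.uncurry (taskGap (n := n) X μ)) := by
  have h1 : Measurable fun A => ∫ x, X A x ∂μ :=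
    hX.stronglyMeasurable.integral_prod_right.measurable
  refine (h1.comp measurable_fst).sub (Measurable.div_const ?_ _)
  refine Finset.measurable_sum _ fun i _ => ?_
  exact hX.comp (measurable_fst.prodMk ((measurable_pi_apply i).comp measurable_snd))

theorem abs_taskGap_le_one {𝒜 T : Type*} [MeasurableSpace 𝒜] [MeasurableSpace T] {n : ℕ}
    (hn : 0 < n) {X : 𝒜 → T → ℝ} (hX : Measurable (Function.uncurry X))
    (hX01 : ∀ A x, X A x ∈ Set.Icc (0 : ℝ) 1) (μ : Measure T) [IsProbabilityMeasure μ]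
    (A : 𝒜) (t : Fin n → T) : |taskGap X μ A t| ≤ 1 := by
  have h := integral_mem_Icc_zero_one μ (hX.of_uncurry_left (x := A)) (hX01 A)
  have hn0 : (0 : ℝ) < n := by exact_mod_cast hn
  have h0 : 0 ≤ (∑ i, X A (t i)) / n :=
    div_nonneg (Finset.sum_nonneg fun i _ => (hX01 A (t i)).1) hn0.le
  have h1 : (∑ i, X A (t i)) / n ≤ 1 := by
    rw [div_le_one hn0]
    exact (Finset.sum_le_card_nsmul _ _ 1 fun i _ => (hX01 A (t i)).2).trans_eq (by simp)
  rw [abs_le, taskGap]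
  constructor <;> linarith [h.1, h.2]

theorem abs_two_mul_taskGap_sq_le {𝒜 T : Type*} [MeasurableSpace 𝒜] [MeasurableSpace T] {n : ℕ}
    (hn : 0 < n) {X : 𝒜 → T → ℝ} (hX : Measurable (Function.uncurry X))
    (hX01 : ∀ A x, X A x ∈ Set.Icc (0 : ℝ) 1) (μ : Measure T) [IsProbabilityMeasure μ]
    (A : 𝒜) (t : Fin n → T) : |(2 * n : ℝ) * taskGap X μ A t ^ 2| ≤ 2 * n := by
  rw [abs_of_nonneg (by positivity)]
  have := (sq_le_one_iff_abs_le_one _).mpr (abs_taskGap_le_one hn hX hX01 μ A t)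
  have h2 : (0 : ℝ) ≤ 2 * n := by positivity
  nlinarith

/-- The exponential moment of the squared gaps under the meta-prior `π`. -/
noncomputable def taskMoment {𝒜 T : Type*} [MeasurableSpace 𝒜] [MeasurableSpace T] {n : ℕ}
    (X : 𝒜 → T → ℝ) (μ : Measure T) (π : Measure 𝒜) (t : Fin n → T) : ℝ :=
  ∫ A, Real.exp ((2 * n : ℝ) * taskGap X μ A t ^ 2) ∂π

section

variable {𝒜 T : Type*} [MeasurableSpace 𝒜] [MeasurableSpace T] {n : ℕ} {X : 𝒜 → T → ℝ}

theorem measurable_uncurry_exp_taskGap_sq (hX : Measurable (Function.uncurry X)) (μ : Measure T)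
    [SFinite μ] :
    Measurable fun p : 𝒜 × (Fin n → T) => Real.exp ((2 * n : ℝ) * taskGap X μ p.1 p.2 ^ 2) :=
  (((measurable_uncurry_taskGap hX μ).pow_const 2).const_mul _).exp

theorem measurable_taskMoment (hX : Measurable (Function.uncurry X)) (μ : Measure T) [SFinite μ]
    (π : Measure 𝒜) [SFinite π] : Measurable (taskMoment (n := n) X μ π) :=
  (measurable_uncurry_exp_taskGap_sq hX μ).stronglyMeasurable.integral_prod_left'.measurable

theorem one_sub_le_measureReal_taskMoment_lt (hn : 0 < n) (hX : Measurable (Function.uncurry X))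
    (hX01 : ∀ A x, X A x ∈ Set.Icc (0 : ℝ) 1) (μ : Measure T) [IsProbabilityMeasure μ]
    (π : Measure 𝒜) [IsProbabilityMeasure π] {δ : ℝ} (hδ : 0 < δ) :
    1 - δ ≤ (Measure.pi fun _ : Fin n => μ).real
      {t | taskMoment X μ π t < 2 * Real.sqrt n / δ} := by
  have hn0 : (0 : ℝ) < n := by exact_mod_cast hn
  have hmem : ∀ A (t : Fin n → T), Real.exp ((2 * n : ℝ) * taskGap X μ A t ^ 2)
      ∈ Set.Icc 0 (Real.exp (2 * n)) := fun A t =>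
    ⟨(Real.exp_pos _).le, Real.exp_le_exp.mpr
      (abs_le.mp (abs_two_mul_taskGap_sq_le hn hX hX01 μ A t)).2⟩
  have hint : Integrable
      (fun p : 𝒜 × (Fin n → T) => Real.exp ((2 * n : ℝ) * taskGap X μ p.1 p.2 ^ 2))
      (π.prod (Measure.pi fun _ => μ)) :=
    .of_mem_Icc _ _ (measurable_uncurry_exp_taskGap_sq hX μ).aemeasurable
      (ae_of_all _ fun p => hmem p.1 p.2)
  refine one_sub_le_measureReal_lt_of_integral_le _ (measurable_taskMoment hX μ π)
    hint.integral_prod_right (fun t => integral_nonneg fun A => (Real.exp_pos _).le)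
    (by positivity) hδ ?_
  unfold taskMoment
  rw [← integral_integral_swap hint]
  have := integral_mono hint.integral_prod_left (integrable_const (2 * Real.sqrt n)) fun A =>
    integral_exp_two_mul_sq_sub_mean_le μ (hX.of_uncurry_left (x := A)) (hX01 A) hn
  simpa using this

theorem ofReal_two_mul_integral_taskGap_sq_le (hn : 0 < n) (hX : Measurable (Function.uncurry X))
    (hX01 : ∀ A x, X A x ∈ Set.Icc (0 : ℝ) 1) (μ : Measure T) [IsProbabilityMeasure μ]
    (π ρ : Measure 𝒜) [IsProbabilityMeasure π] [IsProbabilityMeasure ρ] {t : Fin n → T} {K : ℝ}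
    (ht : taskMoment X μ π t ≤ K) :
    ENNReal.ofReal ((2 * n : ℝ) * (∫ A, taskGap X μ A t ∂ρ) ^ 2) ≤
      klDiv ρ π + ENNReal.ofReal (Real.log K) := by
  have hm : Measurable fun A => taskGap X μ A t :=
    (measurable_uncurry_taskGap hX μ).of_uncurry_right (y := t)
  have hm2 : Measurable fun A => (2 * n : ℝ) * taskGap X μ A t ^ 2 := (hm.pow_const 2).const_mul _
  have hb := fun A => abs_two_mul_taskGap_sq_le hn hX hX01 μ A t
  have hi : Integrable (fun A => taskGap X μ A t) ρ :=
    .of_bound hm.aestronglyMeasurable 1 (ae_of_all _ fun A => abs_taskGap_le_one hn hX hX01 μ A t)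
  have hi2 : Integrable (fun A => taskGap X μ A t ^ 2) ρ := by
    refine .of_bound (hm.pow_const 2).aestronglyMeasurable 1 (ae_of_all _ fun A => ?_)
    rw [Real.norm_eq_abs, abs_of_nonneg (sq_nonneg _)]
    exact (sq_le_one_iff_abs_le_one _).mpr (abs_taskGap_le_one hn hX hX01 μ A t)
  have hjensen : 2 * n * (∫ A, taskGap X μ A t ∂ρ) ^ 2
      ≤ ∫ A, (2 * n : ℝ) * taskGap X μ A t ^ 2 ∂ρ := by
    rw [integral_const_mul]
    exact mul_le_mul_of_nonneg_left (sq_integral_le_integral_sq ρ hi hi2) (by positivity)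
  have hpos := (abs_log_integral_exp_le π hm2 hb).2
  have hlog := Real.log_le_log hpos ht
  calc ENNReal.ofReal ((2 * n : ℝ) * (∫ A, taskGap X μ A t ∂ρ) ^ 2)
      ≤ ENNReal.ofReal ((∫ A, (2 * n : ℝ) * taskGap X μ A t ^ 2 ∂ρ
          - Real.log (∫ A, Real.exp ((2 * n : ℝ) * taskGap X μ A t ^ 2) ∂π)) + Real.log K) :=
        ENNReal.ofReal_le_ofReal (by linarith)
    _ ≤ _ := ENNReal.ofReal_add_le.trans
        (add_le_add_left (ofReal_integral_sub_log_integral_exp_le_klDiv ρ π hm2 hb) _)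

end

/-! ### Deviations within tasks -/

namespace MetaLearning

section Risks

variable {Z F : Type*} [MeasurableSpace Z] [MeasurableSpace F] {ℓ : Z → F → ℝ}

theorem measurable_stochLoss (hℓ : Measurable (Function.uncurry ℓ)) :
    Measurable fun p : Z × ProbabilityMeasure F => stochLoss ℓ p.1 p.2 :=
  measurable_snd.integral_probabilityMeasure (f := fun (p : Z × ProbabilityMeasure F) f => ℓ p.1 f)
    (hℓ.comp ((measurable_fst.comp measurable_fst).prodMk measurable_snd))

theorem stochLoss_mem_Icc (hℓ : Measurable (Function.uncurry ℓ))
    (hℓ01 : ∀ z f, ℓ z f ∈ Set.Icc (0 : ℝ) 1) (z : Z) (Q : ProbabilityMeasure F) :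
    stochLoss ℓ z Q ∈ Set.Icc (0 : ℝ) 1 :=
  integral_mem_Icc_zero_one _ hℓ.of_uncurry_left (hℓ01 z)

theorem measurable_expectedRisk (hℓ : Measurable (Function.uncurry ℓ)) :
    Measurable fun p : ProbabilityMeasure Z × ProbabilityMeasure F => expectedRisk ℓ p.1 p.2 :=
  measurable_fst.integral_probabilityMeasure
    (f := fun (p : ProbabilityMeasure Z × ProbabilityMeasure F) z => stochLoss ℓ z p.2)
    ((measurable_stochLoss hℓ).comp (measurable_snd.prodMk (measurable_snd.comp measurable_fst)))

theorem expectedRisk_mem_Icc (hℓ : Measurable (Function.uncurry ℓ))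
    (hℓ01 : ∀ z f, ℓ z f ∈ Set.Icc (0 : ℝ) 1) (D : ProbabilityMeasure Z)
    (Q : ProbabilityMeasure F) : expectedRisk ℓ D Q ∈ Set.Icc (0 : ℝ) 1 :=
  integral_mem_Icc_zero_one _ ((measurable_stochLoss hℓ).comp (measurable_prodMk_right (y := Q)))
    fun z => stochLoss_mem_Icc hℓ hℓ01 z Q

/-- The expected risk `E_{z ∼ D} ℓ(z, f)` of a deterministic model. -/
noncomputable def modelRisk (ℓ : Z → F → ℝ) (D : ProbabilityMeasure Z) (f : F) : ℝ :=
  ∫ z, ℓ z f ∂(D : Measure Z)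

theorem measurable_modelRisk (hℓ : Measurable (Function.uncurry ℓ)) :
    Measurable fun p : ProbabilityMeasure Z × F => modelRisk ℓ p.1 p.2 :=
  measurable_fst.integral_probabilityMeasure (f := fun (p : ProbabilityMeasure Z × F) z => ℓ z p.2)
    (hℓ.comp (measurable_snd.prodMk (measurable_snd.comp measurable_fst)))

theorem modelRisk_mem_Icc (hℓ : Measurable (Function.uncurry ℓ))
    (hℓ01 : ∀ z f, ℓ z f ∈ Set.Icc (0 : ℝ) 1) (D : ProbabilityMeasure Z) (f : F) :
    modelRisk ℓ D f ∈ Set.Icc (0 : ℝ) 1 :=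
  integral_mem_Icc_zero_one _ hℓ.of_uncurry_right fun z => hℓ01 z f

theorem integral_modelRisk (hℓ : Measurable (Function.uncurry ℓ))
    (hℓ01 : ∀ z f, ℓ z f ∈ Set.Icc (0 : ℝ) 1) (D : ProbabilityMeasure Z)
    (Q : ProbabilityMeasure F) :
    ∫ f, modelRisk ℓ D f ∂(Q : Measure F) = expectedRisk ℓ D Q := by
  have hint : Integrable (Function.uncurry ℓ) ((D : Measure Z).prod (Q : Measure F)) :=
    .of_mem_Icc 0 1 hℓ.aemeasurable (ae_of_all _ fun p => hℓ01 p.1 p.2)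
  exact (integral_integral_swap hint).symm

/-- The exponent `s ∑ⱼ (L(D, f) - ℓ(zⱼ, f)) - m s² / 8` of a task `(D, (z₁, …, z_m))`, with the
bound on the cumulant generating function from Hoeffding's lemma already subtracted. -/
noncomputable def withinExponent {m : ℕ} (ℓ : Z → F → ℝ) (s : ℝ) (t : Task Z m) (f : F) : ℝ :=
  s * ∑ j, (modelRisk ℓ t.1 f - ℓ (t.2 j) f) - m * (s ^ 2 / 8)

variable {m n : ℕ}

theorem measurable_withinExponent (hℓ : Measurable (Function.uncurry ℓ)) (s : ℝ) :
    Measurable fun p : Task Z m × F => withinExponent ℓ s p.1 p.2 := by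
  refine Measurable.sub_const (Measurable.const_mul ?_ _) _
  refine Finset.measurable_sum _ fun j _ => Measurable.sub ?_ ?_
  · exact (measurable_modelRisk hℓ).comp
      ((measurable_fst.comp measurable_fst).prodMk measurable_snd)
  · have hj : Measurable fun p : Task Z m × F => p.1.2 j :=
      (measurable_pi_apply j).comp (measurable_snd.comp measurable_fst)
    exact hℓ.comp (hj.prodMk measurable_snd)

theorem abs_withinExponent_le (hℓ : Measurable (Function.uncurry ℓ))
    (hℓ01 : ∀ z f, ℓ z f ∈ Set.Icc (0 : ℝ) 1) (s : ℝ) (t : Task Z m) (f : F) :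
    |withinExponent ℓ s t f| ≤ |s| * m + m * (s ^ 2 / 8) := by
  have hsum : |∑ j, (modelRisk ℓ t.1 f - ℓ (t.2 j) f)| ≤ m := by
    refine (Finset.abs_sum_le_sum_abs _ _).trans ((Finset.sum_le_card_nsmul _ _ 1
      fun j _ => ?_).trans_eq (by simp))
    have h1 := modelRisk_mem_Icc hℓ hℓ01 t.1 f
    have h2 := hℓ01 (t.2 j) f
    rw [abs_le]
    constructor <;> linarith [h1.1, h1.2, h2.1, h2.2]
  refine (abs_sub _ _).trans (add_le_add ?_ (le_of_eq (abs_of_nonneg (by positivity))))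
  rw [abs_mul]
  gcongr

/-- Hoeffding's lemma for the `m` examples, conditionally on the data distribution. -/
theorem integral_exp_withinExponent_taskLaw_le_one (hℓ : Measurable (Function.uncurry ℓ))
    (hℓ01 : ∀ z f, ℓ z f ∈ Set.Icc (0 : ℝ) 1) (ν : ProbabilityMeasure (ProbabilityMeasure Z))
    (s : ℝ) (f : F) :
    ∫ t, Real.exp (withinExponent ℓ s t f) ∂(taskLaw ν m) ≤ 1 := by
  have hm : Measurable fun t : Task Z m => withinExponent ℓ s t f :=
    Measurable.of_uncurry_right (f := withinExponent ℓ s) (measurable_withinExponent hℓ s)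
  have hi : Integrable (fun t => Real.exp (withinExponent ℓ s t f)) (taskLaw ν m) :=
    .of_mem_Icc 0 (Real.exp (|s| * m + m * (s ^ 2 / 8))) hm.exp.aemeasurable
      (ae_of_all _ fun t => ⟨(Real.exp_pos _).le, Real.exp_le_exp.mpr
        (abs_le.mp (abs_withinExponent_le hℓ hℓ01 s t f)).2⟩)
  unfold taskLaw at hi ⊢
  rw [Measure.integral_compProd hi]
  have hD : ∀ D : ProbabilityMeasure Z,
      ∫ S, Real.exp (withinExponent ℓ s (D, S) f) ∂(sampleKernel Z m D) ≤ 1 := by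
    intro D
    have h := integral_exp_mul_sum_sub_le (D : Measure Z) (X := fun z => ℓ z f)
      hℓ.of_uncurry_right (fun z => hℓ01 z f) m s
    simp only [withinExponent, Real.exp_sub]
    rw [integral_div, div_le_one (Real.exp_pos _)]
    exact h
  have := integral_mono hi.integral_compProd (integrable_const 1) hD
  simpa using this

/-- The moment of the hyper-prior controlling all within-task gaps at the slope `s`. -/
noncomputable def withinMoment (ℓ : Z → F → ℝ) (hyperPrior : HyperDistribution F) (s : ℝ)
    (t : Fin n → Task Z m) : ℝ :=
  ∫ P, ∏ i, ∫ f, Real.exp (withinExponent ℓ s (t i) f) ∂(P : Measure F)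
    ∂(hyperPrior : Measure (ProbabilityMeasure F))

theorem measurable_integral_exp_withinExponent (hℓ : Measurable (Function.uncurry ℓ)) (s : ℝ) :
    Measurable fun p : ProbabilityMeasure F × Task Z m =>
      ∫ f, Real.exp (withinExponent ℓ s p.2 f) ∂(p.1 : Measure F) :=
  measurable_fst.integral_probabilityMeasure
    (f := fun (p : ProbabilityMeasure F × Task Z m) f => Real.exp (withinExponent ℓ s p.2 f))
    ((measurable_withinExponent (m := m) hℓ s).comp
      ((measurable_snd.comp measurable_fst).prodMk measurable_snd)).exp

theorem integral_exp_withinExponent_mem_Icc (hℓ : Measurable (Function.uncurry ℓ))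
    (hℓ01 : ∀ z f, ℓ z f ∈ Set.Icc (0 : ℝ) 1) (s : ℝ) (P : ProbabilityMeasure F)
    (t : Task Z m) :
    ∫ f, Real.exp (withinExponent ℓ s t f) ∂(P : Measure F)
      ∈ Set.Icc 0 (Real.exp (|s| * m + m * (s ^ 2 / 8))) := by
  have hm : Measurable (withinExponent ℓ s t) :=
    Measurable.of_uncurry_left (f := withinExponent ℓ s) (measurable_withinExponent hℓ s)
  obtain ⟨h1, h2⟩ := abs_log_integral_exp_le (P : Measure F) hm
    (abs_withinExponent_le hℓ hℓ01 s t)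
  exact ⟨h2.le, (Real.log_le_iff_le_exp h2).mp (abs_le.mp h1).2⟩

theorem integrable_prod_integral_exp_withinExponent (hℓ : Measurable (Function.uncurry ℓ))
    (hℓ01 : ∀ z f, ℓ z f ∈ Set.Icc (0 : ℝ) 1) (s : ℝ)
    (μ : Measure (ProbabilityMeasure F × (Fin n → Task Z m))) [IsFiniteMeasure μ] :
    Integrable (fun p => ∏ i, ∫ f, Real.exp (withinExponent ℓ s (p.2 i) f) ∂(p.1 : Measure F))
      μ := by
  refine .of_mem_Icc 0 (Real.exp (|s| * m + m * (s ^ 2 / 8)) ^ n)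
    (Measurable.aemeasurable ?_) (ae_of_all _ fun p => ⟨?_, ?_⟩)
  · exact Finset.measurable_prod _ fun i _ => (measurable_integral_exp_withinExponent hℓ s).comp
      (measurable_fst.prodMk ((measurable_pi_apply i).comp measurable_snd))
  · exact Finset.prod_nonneg fun i _ =>
      (integral_exp_withinExponent_mem_Icc hℓ hℓ01 s p.1 (p.2 i)).1
  · refine (Finset.prod_le_prod (fun i _ => ?_) fun i _ => ?_).trans_eq (by
      rw [Finset.prod_const, Finset.card_univ, Fintype.card_fin])
    · exact (integral_exp_withinExponent_mem_Icc hℓ hℓ01 s p.1 (p.2 i)).1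
    · exact (integral_exp_withinExponent_mem_Icc hℓ hℓ01 s p.1 (p.2 i)).2

theorem measurable_withinMoment (hℓ : Measurable (Function.uncurry ℓ))
    (hyperPrior : HyperDistribution F) (s : ℝ) :
    Measurable (withinMoment (m := m) (n := n) ℓ hyperPrior s) := by
  have h : Measurable fun p : ProbabilityMeasure F × (Fin n → Task Z m) =>
      ∏ i, ∫ f, Real.exp (withinExponent ℓ s (p.2 i) f) ∂(p.1 : Measure F) :=
    Finset.measurable_prod _ fun i _ => (measurable_integral_exp_withinExponent hℓ s).comp
      (measurable_fst.prodMk ((measurable_pi_apply i).comp measurable_snd))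
  exact h.stronglyMeasurable.integral_prod_left'.measurable

theorem withinMoment_nonneg (ℓ : Z → F → ℝ) (hyperPrior : HyperDistribution F) (s : ℝ)
    (t : Fin n → Task Z m) : 0 ≤ withinMoment ℓ hyperPrior s t :=
  integral_nonneg fun _ => Finset.prod_nonneg fun _ _ => integral_nonneg fun _ =>
    (Real.exp_pos _).le

theorem integrable_withinMoment (hℓ : Measurable (Function.uncurry ℓ))
    (hℓ01 : ∀ z f, ℓ z f ∈ Set.Icc (0 : ℝ) 1) (ν : ProbabilityMeasure (ProbabilityMeasure Z))
    (hyperPrior : HyperDistribution F) (s : ℝ) :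
    Integrable (withinMoment ℓ hyperPrior s) (trainingLaw ν m n) :=
  (integrable_prod_integral_exp_withinExponent hℓ hℓ01 s
    ((hyperPrior : Measure (ProbabilityMeasure F)).prod (trainingLaw ν m n))).integral_prod_right

/-- Only the independence of the tasks is used to exchange the product with the integral. -/
theorem integral_withinMoment_le_one (hℓ : Measurable (Function.uncurry ℓ))
    (hℓ01 : ∀ z f, ℓ z f ∈ Set.Icc (0 : ℝ) 1) (ν : ProbabilityMeasure (ProbabilityMeasure Z))
    (hyperPrior : HyperDistribution F) (s : ℝ) :
    ∫ t, withinMoment ℓ hyperPrior s t ∂(trainingLaw ν m n) ≤ 1 := by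
  have hint := integrable_prod_integral_exp_withinExponent (n := n) (m := m) hℓ hℓ01 s
    ((hyperPrior : Measure (ProbabilityMeasure F)).prod (trainingLaw ν m n))
  unfold withinMoment
  rw [← integral_integral_swap hint]
  have hP : ∀ P : ProbabilityMeasure F,
      ∫ t : Fin n → Task Z m, ∏ i, ∫ f, Real.exp (withinExponent ℓ s (t i) f) ∂(P : Measure F)
        ∂(trainingLaw ν m n) ≤ 1 := by
    intro P
    unfold trainingLaw
    rw [integral_fintype_prod_eq_prod
      (f := fun (_ : Fin n) t => ∫ f, Real.exp (withinExponent ℓ s t f) ∂(P : Measure F))]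
    refine Finset.prod_le_one (fun i _ => integral_nonneg fun t => integral_nonneg fun f =>
      (Real.exp_pos _).le) fun i _ => ?_
    have hi : Integrable (fun p : Task Z m × F => Real.exp (withinExponent ℓ s p.1 p.2))
        ((taskLaw ν m).prod (P : Measure F)) :=
      .of_mem_Icc 0 (Real.exp (|s| * m + m * (s ^ 2 / 8)))
        (measurable_withinExponent hℓ s).exp.aemeasurable
        (ae_of_all _ fun p => ⟨(Real.exp_pos _).le, Real.exp_le_exp.mpr
          (abs_le.mp (abs_withinExponent_le hℓ hℓ01 s p.1 p.2)).2⟩)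
    rw [integral_integral_swap hi]
    have := integral_mono hi.integral_prod_right (integrable_const 1) fun f =>
      integral_exp_withinExponent_taskLaw_le_one (m := m) hℓ hℓ01 ν s f
    simpa using this
  have := integral_mono hint.integral_prod_left (integrable_const 1) hP
  simpa using this

end Risks

end MetaLearning

/-! ### The within-task bound -/

namespace MetaLearning

section Bound

variable {Z F : Type*} [MeasurableSpace Z] [MeasurableSpace F] {ℓ : Z → F → ℝ} {m n : ℕ}

/-- The gap between expected and empirical risk of the posteriors `Q i`, averaged over the `n`
tasks. -/
noncomputable def withinGap (ℓ : Z → F → ℝ) (t : Fin n → Task Z m)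
    (Q : Fin n → ProbabilityMeasure F) : ℝ :=
  (∑ i, (expectedRisk ℓ (t i).1 (Q i) - empiricalRisk ℓ (t i).2 (Q i))) / n

theorem empiricalRisk_mem_Icc (hm : 0 < m) (hℓ : Measurable (Function.uncurry ℓ))
    (hℓ01 : ∀ z f, ℓ z f ∈ Set.Icc (0 : ℝ) 1) (S : Dataset Z m) (Q : ProbabilityMeasure F) :
    empiricalRisk ℓ S Q ∈ Set.Icc (0 : ℝ) 1 := by
  have hm0 : (0 : ℝ) < m := by exact_mod_cast hm
  have h0 : 0 ≤ ∑ j, stochLoss ℓ (S j) Q :=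
    Finset.sum_nonneg fun j _ => (stochLoss_mem_Icc hℓ hℓ01 (S j) Q).1
  have h1 : ∑ j, stochLoss ℓ (S j) Q ≤ m :=
    (Finset.sum_le_card_nsmul _ _ 1 fun j _ => (stochLoss_mem_Icc hℓ hℓ01 (S j) Q).2).trans_eq
      (by simp)
  unfold empiricalRisk
  rw [one_div_mul_eq_div]
  exact ⟨div_nonneg h0 hm0.le, (div_le_one hm0).mpr h1⟩

theorem abs_withinGap_le_one (hm : 0 < m) (hn : 0 < n) (hℓ : Measurable (Function.uncurry ℓ))
    (hℓ01 : ∀ z f, ℓ z f ∈ Set.Icc (0 : ℝ) 1) (t : Fin n → Task Z m)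
    (Q : Fin n → ProbabilityMeasure F) : |withinGap ℓ t Q| ≤ 1 := by
  have hn0 : (0 : ℝ) < n := by exact_mod_cast hn
  unfold withinGap
  rw [abs_div, Nat.abs_cast, div_le_one hn0]
  refine (Finset.abs_sum_le_sum_abs _ _).trans ((Finset.sum_le_card_nsmul _ _ 1
    fun i _ => ?_).trans_eq (by simp))
  have h1 := expectedRisk_mem_Icc hℓ hℓ01 (t i).1 (Q i)
  have h2 := empiricalRisk_mem_Icc hm hℓ hℓ01 (t i).2 (Q i)
  rw [abs_le]
  constructor <;> linarith [h1.1, h1.2, h2.1, h2.2]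

theorem sum_integral_withinExponent (hm : 0 < m) (hn : 0 < n)
    (hℓ : Measurable (Function.uncurry ℓ)) (hℓ01 : ∀ z f, ℓ z f ∈ Set.Icc (0 : ℝ) 1)
    (t : Fin n → Task Z m) (Q : Fin n → ProbabilityMeasure F) (s : ℝ) :
    ∑ i, ∫ f, withinExponent ℓ s (t i) f ∂(Q i : Measure F)
      = s * ((m * n : ℕ) * withinGap ℓ t Q) - (m * n : ℕ) * (s ^ 2 / 8) := by
  have hm0 : (0 : ℝ) < m := by exact_mod_cast hm
  have hn0 : (0 : ℝ) < n := by exact_mod_cast hn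
  have hi : ∀ i, ∫ f, withinExponent ℓ s (t i) f ∂(Q i : Measure F)
      = s * (m * (expectedRisk ℓ (t i).1 (Q i) - empiricalRisk ℓ (t i).2 (Q i)))
        - m * (s ^ 2 / 8) := by
    intro i
    have h1 : Integrable (modelRisk ℓ (t i).1) (Q i : Measure F) :=
      .of_mem_Icc 0 1 (Measurable.of_uncurry_left (f := modelRisk ℓ)
        (measurable_modelRisk hℓ)).aemeasurable
        (ae_of_all _ fun f => modelRisk_mem_Icc hℓ hℓ01 _ f)
    have h2 : ∀ j, Integrable (fun f => ℓ ((t i).2 j) f) (Q i : Measure F) := fun j =>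
      .of_mem_Icc 0 1 (hℓ.of_uncurry_left (x := (t i).2 j)).aemeasurable
        (ae_of_all _ fun f => hℓ01 _ f)
    have h12 : ∀ j, Integrable (fun f => modelRisk ℓ (t i).1 f - ℓ ((t i).2 j) f)
        (Q i : Measure F) := fun j => h1.sub (h2 j)
    have h3 : Integrable (fun f => ∑ j, (modelRisk ℓ (t i).1 f - ℓ ((t i).2 j) f))
        (Q i : Measure F) := integrable_finsetSum _ fun j _ => h12 j
    unfold withinExponent
    rw [integral_sub (h3.const_mul s) (integrable_const _), integral_const_mul,
      integral_finsetSum _ fun j _ => h12 j]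
    simp_rw [fun j => integral_sub h1 (h2 j), integral_modelRisk hℓ hℓ01]
    rw [Finset.sum_sub_distrib]
    simp only [Finset.sum_const, Finset.card_univ, Fintype.card_fin, nsmul_eq_mul,
      integral_const, probReal_univ, one_smul, empiricalRisk, stochLoss]
    field_simp
  simp_rw [hi]
  rw [Finset.sum_sub_distrib, ← Finset.mul_sum, ← Finset.mul_sum]
  simp only [Finset.sum_const, Finset.card_univ, Fintype.card_fin, nsmul_eq_mul, withinGap]
  push_cast
  field_simp

/-- The within-task bound, for arbitrary posteriors `Q i`, on the event where the moments of all
slopes `4 k / (m n)` are at most `K`. -/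
theorem ofReal_two_mul_withinGap_sq_le (hm : 0 < m) (hn : 0 < n)
    (hℓ : Measurable (Function.uncurry ℓ)) (hℓ01 : ∀ z f, ℓ z f ∈ Set.Icc (0 : ℝ) 1)
    (hyperPrior hyperPost : HyperDistribution F) (t : Fin n → Task Z m)
    (Q : Fin n → ProbabilityMeasure F) {K : ℝ}
    (hK : ∀ k ∈ Finset.range (m * n + 1),
      withinMoment ℓ hyperPrior (4 * (k / (m * n : ℕ))) t ≤ K)
    (hgap : 0 ≤ withinGap ℓ t Q) :
    ENNReal.ofReal (2 * (m * n : ℕ) * withinGap ℓ t Q ^ 2) ≤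
      klDiv (hyperPost : Measure (ProbabilityMeasure F))
          (hyperPrior : Measure (ProbabilityMeasure F)) +
        ∫⁻ P, ∑ i, klDiv (Q i : Measure F) (P : Measure F)
          ∂(hyperPost : Measure (ProbabilityMeasure F)) +
        ENNReal.ofReal (Real.log K) + 1 := by
  obtain ⟨k, hk, hkx⟩ := exists_nat_le_two_mul_sq_sub_div_le (Nat.mul_pos hm hn) hgap
    (abs_le.mp (abs_withinGap_le_one hm hn hℓ hℓ01 t Q)).2
  have hsum := sum_integral_withinExponent hm hn hℓ hℓ01 t Q (4 * (k / (m * n : ℕ)))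
  set x := withinGap ℓ t Q
  set s : ℝ := 4 * (k / (m * n : ℕ)) with hs
  have hmeas : ∀ i, Measurable (withinExponent ℓ s (t i)) := fun i =>
    Measurable.of_uncurry_left (f := withinExponent ℓ s) (measurable_withinExponent hℓ s)
  have hDV := ofReal_sum_integral_sub_log_integral_prod_le hyperPost hyperPrior Q hmeas
    (fun i f => abs_withinExponent_le hℓ hℓ01 s (t i) f)
  have hpos : 0 < withinMoment ℓ hyperPrior s t := integral_prod_integral_exp_pos hyperPrior hmeas
    fun i f => abs_withinExponent_le hℓ hℓ01 s (t i) f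
  have hlog : Real.log (withinMoment ℓ hyperPrior s t) ≤ Real.log K :=
    Real.log_le_log hpos (hK k hk)
  -- The first summand is the tangent to `x ↦ 2 m n x²` at `k / (m n)`, written with
  -- `s = 4 k / (m n)`.
  have hquad : 2 * ((m * n : ℕ) : ℝ) * x ^ 2
      = (s * ((m * n : ℕ) * x) - (m * n : ℕ) * (s ^ 2 / 8))
        + 2 * ((m * n : ℕ) : ℝ) * (x - k / (m * n : ℕ)) ^ 2 := by
    rw [hs]; ring
  calc ENNReal.ofReal (2 * ((m * n : ℕ) : ℝ) * x ^ 2)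
      ≤ ENNReal.ofReal ((∑ i, ∫ f, withinExponent ℓ s (t i) f ∂(Q i : Measure F)
          - Real.log (withinMoment ℓ hyperPrior s t)) + Real.log K + 1) := by
        refine ENNReal.ofReal_le_ofReal ?_
        rw [hsum]
        linarith
    _ ≤ ENNReal.ofReal (∑ i, ∫ f, withinExponent ℓ s (t i) f ∂(Q i : Measure F)
          - Real.log (withinMoment ℓ hyperPrior s t)) + ENNReal.ofReal (Real.log K) + 1 := by
        refine ENNReal.ofReal_add_le.trans ?_
        rw [ENNReal.ofReal_one]
        gcongr
        exact ENNReal.ofReal_add_le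
    _ ≤ _ := by gcongr; exact hDV

end Bound

end MetaLearning

/-! ### Combination of the two levels -/

theorem theorem2 {Z F 𝒜 : Type*} [MeasurableSpace Z] [MeasurableSpace F] [MeasurableSpace 𝒜]
    (m n : ℕ) (hm : 0 < m) (hn : 0 < n)
    (ℓ : Z → F → ℝ) (hℓ_meas : Measurable (Function.uncurry ℓ))
    (hℓ_range : ∀ z f, ℓ z f ∈ Set.Icc (0 : ℝ) 1)
    (alg : 𝒜 → MetaLearning.LearningAlgorithm Z F m)
    (halg : Measurable (Function.uncurry alg))
    (ν : ProbabilityMeasure (ProbabilityMeasure Z))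
    (π : ProbabilityMeasure 𝒜)
    (hyperPrior : MetaLearning.HyperDistribution F)
    (δ : ℝ) (hδ : 0 < δ) :
    ∃ E : Set (Fin n → MetaLearning.Task Z m),
      MeasurableSet E ∧
      ENNReal.ofReal (1 - δ) ≤ MetaLearning.trainingLaw ν m n E ∧
      ∀ t ∈ E, ∀ (ρ : ProbabilityMeasure 𝒜) (hyperPost : 𝒜 → MetaLearning.HyperDistribution F),
        ENNReal.ofReal (MetaLearning.metaRisk ℓ alg ν ρ) ≤
          ENNReal.ofReal (MetaLearning.metaEmpiricalRisk ℓ alg (fun i => (t i).2) ρ) +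
          MetaLearning.taskTerm n δ π ρ +
          MetaLearning.withinTerm alg (fun i => (t i).2) δ hyperPrior hyperPost ρ := by
  have hm1 : (1 : ℝ) ≤ m := by exact_mod_cast hm
  have hn1 : (1 : ℝ) ≤ n := by exact_mod_cast hn
  have hN1 : (1 : ℝ) ≤ m * n := one_le_mul_of_one_le_of_one_le hm1 hn1
  set X : 𝒜 → MetaLearning.Task Z m → ℝ := fun A t =>
    MetaLearning.expectedRisk ℓ t.1 (alg A t.2) with hX
  have halg' : ∀ i, ∀ t : Fin n → MetaLearning.Task Z m, Measurable fun A => alg A (t i).2 :=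
    fun i t => halg.of_uncurry_right (y := (t i).2)
  have hXm : Measurable (Function.uncurry X) := by
    have h1 : Measurable fun p : 𝒜 × MetaLearning.Task Z m => p.2.1 := by fun_prop
    have h2 : Measurable fun p : 𝒜 × MetaLearning.Task Z m => alg p.1 p.2.2 :=
      halg.comp (measurable_fst.prodMk (measurable_snd.comp measurable_snd))
    exact (MetaLearning.measurable_expectedRisk hℓ_meas).comp (h1.prodMk h2)
  have hX01 : ∀ A t, X A t ∈ Set.Icc (0 : ℝ) 1 := fun A t =>
    MetaLearning.expectedRisk_mem_Icc hℓ_meas hℓ_range _ _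
  set H : (Fin n → MetaLearning.Task Z m) → ℝ := fun t => ∑ k ∈ Finset.range (m * n + 1),
    MetaLearning.withinMoment ℓ hyperPrior (4 * (k / (m * n : ℕ))) t with hH
  have hHm : Measurable H := Finset.measurable_sum _ fun k _ =>
    MetaLearning.measurable_withinMoment hℓ_meas hyperPrior _
  set E₁ := {t : Fin n → MetaLearning.Task Z m |
    taskMoment X (MetaLearning.taskLaw ν m) (π : Measure 𝒜) t
    < 2 * Real.sqrt n / (δ / 2)} 
  set E₂ := {t : Fin n → MetaLearning.Task Z m | H t < ((m * n : ℕ) + 1) / (δ / 2)}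
  have hE₁m : MeasurableSet E₁ :=
    measurableSet_lt (measurable_taskMoment hXm _ _) measurable_const
  have hE₂m : MeasurableSet E₂ := measurableSet_lt hHm measurable_const
  refine ⟨E₁ ∩ E₂, hE₁m.inter hE₂m, ?_, ?_⟩
  · have h1 : 1 - δ / 2 ≤ (MetaLearning.trainingLaw ν m n).real E₁ :=
      one_sub_le_measureReal_taskMoment_lt hn hXm hX01 (MetaLearning.taskLaw ν m) (π : Measure 𝒜)
        (half_pos hδ)
    have hHi : ∀ k ∈ Finset.range (m * n + 1), Integrable
        (MetaLearning.withinMoment ℓ hyperPrior (4 * ((k : ℝ) / (m * n : ℕ))))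
        (MetaLearning.trainingLaw ν m n) := fun k _ =>
      MetaLearning.integrable_withinMoment hℓ_meas hℓ_range ν hyperPrior _
    have h2 : 1 - δ / 2 ≤ (MetaLearning.trainingLaw ν m n).real E₂ := by
      refine one_sub_le_measureReal_lt_of_integral_le _ hHm (integrable_finsetSum _ hHi)
        (fun t => Finset.sum_nonneg fun k _ => MetaLearning.withinMoment_nonneg _ _ _ _)
        (by positivity) (half_pos hδ) ?_
      rw [hH, integral_finsetSum _ hHi]
      refine (Finset.sum_le_card_nsmul _ _ 1 fun k _ =>
        MetaLearning.integral_withinMoment_le_one hℓ_meas hℓ_range ν hyperPrior _).trans_eq ?_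
      simp
    have h3 := measureReal_union_add_inter (μ := MetaLearning.trainingLaw ν m n) (s := E₁) hE₂m
    have h4 : (MetaLearning.trainingLaw ν m n).real (E₁ ∪ E₂) ≤ 1 := measureReal_le_one
    rw [← ofReal_measureReal]
    exact ENNReal.ofReal_le_ofReal (by linarith)
  rintro t ⟨ht₁, ht₂⟩ ρ hyperPost
  have hK₁ : taskMoment X (MetaLearning.taskLaw ν m) (π : Measure 𝒜) t ≤ 4 * Real.sqrt n / δ :=
    (le_of_lt ht₁).trans_eq (by field_simp; norm_num)
  have htask : ENNReal.ofReal (∫ A, taskGap X (MetaLearning.taskLaw ν m) A t ∂(ρ : Measure 𝒜))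
      ≤ MetaLearning.taskTerm n δ π ρ := by
    refine ofReal_le_div_rpow_half (by simp [hn.ne']) (by finiteness) fun _ => ?_
    have := ofReal_two_mul_integral_taskGap_sq_le hn hXm hX01 (MetaLearning.taskLaw ν m)
      (π : Measure 𝒜) (ρ : Measure 𝒜) (t := t) hK₁
    simpa using this
  set G : 𝒜 → ℝ := fun A => MetaLearning.withinGap ℓ t fun i => alg A (t i).2 with hG
  have hrisk : ∀ i, Measurable fun A => MetaLearning.expectedRisk ℓ (t i).1 (alg A (t i).2) :=
    fun i => (MetaLearning.measurable_expectedRisk hℓ_meas).comp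
      (measurable_const.prodMk (halg' i t))
  have hemp : ∀ i, Measurable fun A => MetaLearning.empiricalRisk ℓ (t i).2 (alg A (t i).2) :=
    fun i => Measurable.const_mul (Finset.measurable_sum _ fun j _ =>
      (MetaLearning.measurable_stochLoss hℓ_meas).comp (measurable_const.prodMk (halg' i t))) _
  have hGi : Integrable G (ρ : Measure 𝒜) := by
    refine .of_bound (Measurable.aestronglyMeasurable ?_) 1 (ae_of_all _ fun A =>
      MetaLearning.abs_withinGap_le_one hm hn hℓ_meas hℓ_range t _)
    exact (Finset.measurable_sum _ fun i _ => (hrisk i).sub (hemp i)).div_const _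
  have hwithin : ENNReal.ofReal (∫ A, G A ∂(ρ : Measure 𝒜)) ≤
      MetaLearning.withinTerm alg (fun i => (t i).2) δ hyperPrior hyperPost ρ := by
    refine (ofReal_integral_le_lintegral_ofReal hGi).trans (lintegral_mono fun A => ?_)
    refine ofReal_le_div_rpow_half (by simp [hn.ne', hm.ne']) (by finiteness) fun hGA => ?_
    have hK : ∀ k ∈ Finset.range (m * n + 1), MetaLearning.withinMoment ℓ hyperPrior
        (4 * (k / (m * n : ℕ))) t ≤ 8 * m * n / δ := by
      intro k hk
      refine (Finset.single_le_sum (f := fun k : ℕ => MetaLearning.withinMoment ℓ hyperPrior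
        (4 * (k / (m * n : ℕ))) t) (fun k _ => MetaLearning.withinMoment_nonneg _ _ _ _)
        hk).trans (le_of_lt (lt_of_lt_of_le ht₂ ?_))
      -- The number `m n + 1` of grid points is at most `2 m n`.
      rw [div_div_eq_mul_div]
      refine div_le_div_of_nonneg_right ?_ hδ.le
      push_cast
      linarith
    have := MetaLearning.ofReal_two_mul_withinGap_sq_le hm hn hℓ_meas hℓ_range hyperPrior
      (hyperPost A) t (fun i => alg A (t i).2) hK hGA
    refine le_trans (le_of_eq ?_) this
    simp [hG, mul_assoc]
  have hsplit : MetaLearning.metaRisk ℓ alg ν ρ =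
      MetaLearning.metaEmpiricalRisk ℓ alg (fun i => (t i).2) ρ
        + ∫ A, taskGap X (MetaLearning.taskLaw ν m) A t ∂(ρ : Measure 𝒜)
        + ∫ A, G A ∂(ρ : Measure 𝒜) := by
    have hgi : Integrable (fun A => taskGap X (MetaLearning.taskLaw ν m) A t) (ρ : Measure 𝒜) :=
      .of_bound ((measurable_uncurry_taskGap hXm _).of_uncurry_right (y := t)).aestronglyMeasurable
        1 (ae_of_all _ fun A => abs_taskGap_le_one hn hXm hX01 _ A t)
    have hei : Integrable (fun A => (1 / (n : ℝ)) * ∑ i,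
        MetaLearning.empiricalRisk ℓ (t i).2 (alg A (t i).2)) (ρ : Measure 𝒜) :=
      Integrable.const_mul (integrable_finsetSum _ fun i _ =>
        .of_mem_Icc 0 1 (hemp i).aemeasurable (ae_of_all _ fun A =>
          MetaLearning.empiricalRisk_mem_Icc hm hℓ_meas hℓ_range _ _)) _
    have hegi : Integrable (fun A => (1 / (n : ℝ)) * ∑ i,
        MetaLearning.empiricalRisk ℓ (t i).2 (alg A (t i).2)
          + taskGap X (MetaLearning.taskLaw ν m) A t) (ρ : Measure 𝒜) := hei.add hgi
    unfold MetaLearning.metaRisk MetaLearning.metaEmpiricalRisk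
    rw [← integral_add hei hgi, ← integral_add hegi hGi]
    refine integral_congr_ae (ae_of_all _ fun A => ?_)
    simp only [hG, hX, taskGap, MetaLearning.withinGap, Finset.sum_sub_distrib]
    ring
  rw [hsplit]
  exact ENNReal.ofReal_add_le.trans (add_le_add (ENNReal.ofReal_add_le.trans
    (add_le_add_right htask _)) hwithin)
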